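/- Let $d\ge 1$. For $z=(x,\xi)\in\mathbb{R}^{d}\times\mathbb{R}^d=\mathbb{R}^{2d}$ and $f\in L^2(\mathbb{R}^d)$ let $\pi(z)f(t)=e^{2\pi i\xi\cdot t}f(t-x)$. For $g\in L^2(\mathbb{R}^d)$ and a lattice $\Lambda=A\mathbb{Z}^{2d}$, where $A$ is an invertible real $2d\times 2d$ matrix, put $\operatorname{vol}(\Lambda)=|\det A|$. The Gabor system $\mathcal{G}(g,\Lambda)=\{\pi(\lambda)g:\lambda\in\Lambda\}$ is a frame for $L^2(\mathbb{R}^d)$ if there are constants $a,b>0$ with $$a\|f\|_2^2\le\sum_{\lambda\in\Lambda}|\langle f,\pi(\lambda)g\rangle|^2\le b\|f\|_2^2\qquad\text{for all } f\in L^2(\mathbb{R}^d).$$ For $s\in\mathbb{R}$, we say that $g\in L^2(\mathbb{R}^d)$ belongs to $M^\infty_{v_s}(\mathbb{R}^d)$ if there is a constant $C$ such that $|V_gg(z)|\le C(1+|z|)^{-s}$ for all $z\in\mathbb{R}^{2d}$, where $V_gf(x,\xi)=\int_{\mathbb{R}^d}f(t)\,\overline{g(t-x)}\,e^{-2\pi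 i\xi\cdot t}\,dt$. **Corollary (Balian–Low type).** Let $g\in L^2(\mathbb{R}^d)$ and let $\Lambda\subseteq\mathbb{R}^{2d}$ be a lattice with $\operatorname{vol}(\Lambda)=1$. If $\mathcal{G}(g,\Lambda)$ is a frame for $L^2(\mathbb{R}^d)$, then $g\notin M^\infty_{v_s}(\mathbb{R}^d)$ for every $s>2d$. -/

import Mathlib

open MeasureTheory
open scoped ENNReal ComplexConjugate

namespace Gabor

/-- Configuration space `ℝ^d` with its Euclidean structure. -/
abbrev Space (d : ℕ) : Type := EuclideanSpace ℝ (Fin d)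

/-- Phase space `ℝ^{2d}` with its Euclidean structure. The coordinates indexed by `Sum.inl` form
the position `x`, those indexed by `Sum.inr` form the frequency `ξ` of a point `z = (x, ξ)`. -/
abbrev PhaseSpace (d : ℕ) : Type := EuclideanSpace ℝ (Fin d ⊕ Fin d)

/-- The Hilbert space `L²(ℝ^d)` of complex-valued functions. -/
abbrev L2 (d : ℕ) : Type := Lp ℂ 2 (volume : Measure (Space d))

/-- The position component `x` of `z = (x, ξ)`. -/
def position {d : ℕ} (z : PhaseSpace d) : Space d := WithLp.toLp 2 fun i => z (Sum.inl i)

/-- The frequency component `ξ` of `z = (x, ξ)`. -/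
def frequency {d : ℕ} (z : PhaseSpace d) : Space d := WithLp.toLp 2 fun i => z (Sum.inr i)

/-- The time-frequency shift `π(z) f(t) = e^{2π i ξ · t} f(t - x)` of a function `f`. -/
noncomputable def tfShiftFun {d : ℕ} (z : PhaseSpace d) (f : Space d → ℂ) : Space d → ℂ :=
  fun t => Complex.exp (2 * Real.pi * Complex.I * (inner ℝ (frequency z) t : ℝ)) *
    f (t - position z)

theorem memLp_tfShiftFun {d : ℕ} (z : PhaseSpace d) {f : Space d → ℂ}
    (hf : MemLp f 2 (volume : Measure (Space d))) :
    MemLp (tfShiftFun z f) 2 (volume : Measure (Space d)) := by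
  have h := hf.comp_measurePreserving
    (measurePreserving_sub_right (volume : Measure (Space d)) (position z))
  refine h.of_le (AEStronglyMeasurable.mul ?_ h.1) (Filter.Eventually.of_forall fun t => ?_)
  · exact Continuous.aestronglyMeasurable (by fun_prop)
  · have : Complex.exp (2 * Real.pi * Complex.I * (inner ℝ (frequency z) t : ℝ)) =
        Complex.exp (((2 * Real.pi * inner ℝ (frequency z) t : ℝ) : ℂ) * Complex.I) := by
      congr 1
      push_cast
      ring
    simp only [tfShiftFun, norm_mul, this, Complex.norm_exp_ofReal_mul_I, one_mul,
      Function.comp_apply, le_refl]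

/-- The time-frequency shift `π(z)` acting on `L²(ℝ^d)`. -/
noncomputable def tfShift {d : ℕ} (z : PhaseSpace d) (f : L2 d) : L2 d :=
  (memLp_tfShiftFun z (Lp.memLp f)).toLp (tfShiftFun z f)

/-- The short-time Fourier transform
`V_g f (x, ξ) = ∫ f(t) conj(g(t - x)) e^{-2π i ξ · t} dt`. -/
noncomputable def stft {d : ℕ} (g f : L2 d) (z : PhaseSpace d) : ℂ :=
  ∫ t : Space d, f t * conj (g (t - position z)) *
    Complex.exp (-(2 * Real.pi * Complex.I * (inner ℝ (frequency z) t : ℝ)))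

/-- The set `A ℤ^{2d}`, a lattice in phase space when `A` is invertible. -/
def lattice {d : ℕ} (A : Matrix (Fin d ⊕ Fin d) (Fin d ⊕ Fin d) ℝ) : Set (PhaseSpace d) :=
  Set.range fun k : Fin d ⊕ Fin d → ℤ => WithLp.toLp 2 (A.mulVec fun i => (k i : ℝ))

/-- The volume `|det A|` of the lattice `A ℤ^{2d}`. -/
noncomputable def latticeVolume {d : ℕ} (A : Matrix (Fin d ⊕ Fin d) (Fin d ⊕ Fin d) ℝ) : ℝ :=
  |A.det|

/-- The Gabor system `G(g, Λ) = {π(l) g : l ∈ Λ}` is a frame for `L²(ℝ^d)`: there are `a, b > 0`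
with `a ‖f‖² ≤ ∑_{l ∈ Λ} |⟨f, π(l) g⟩|² ≤ b ‖f‖²` for all `f`. The sum is taken in `[0, ∞]`, so
that its convergence is part of the upper bound. Mathlib's inner product is conjugate-linear in
its first argument. -/
def IsGaborFrame {d : ℕ} (g : L2 d) (Λ : Set (PhaseSpace d)) : Prop :=
  ∃ a b : ℝ, 0 < a ∧ 0 < b ∧ ∀ f : L2 d,
    ENNReal.ofReal (a * ‖f‖ ^ 2) ≤
        ∑' l : Λ, ENNReal.ofReal (‖inner ℂ (tfShift (l : PhaseSpace d) g) f‖ ^ 2) ∧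
      ∑' l : Λ, ENNReal.ofReal (‖inner ℂ (tfShift (l : PhaseSpace d) g) f‖ ^ 2) ≤
        ENNReal.ofReal (b * ‖f‖ ^ 2)

/-- Membership `g ∈ M^∞_{v_s}(ℝ^d)`: there is a constant `C` with
`|V_g g(z)| ≤ C (1 + |z|)^{-s}` for all `z ∈ ℝ^{2d}`. -/
def MemModulationInfty {d : ℕ} (s : ℝ) (g : L2 d) : Prop :=
  ∃ C : ℝ, ∀ z : PhaseSpace d, ‖stft g g z‖ ≤ C * (1 + ‖z‖) ^ (-s)

end Gabor

open Filter Topology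

namespace Gabor

/-! ### Plancherel's theorem for the Fourier integral. -/

section Plancherel

variable {E : Type*} [NormedAddCommGroup E] [InnerProductSpace ℝ E] [FiniteDimensional ℝ E]
  [MeasurableSpace E] [BorelSpace E]

/-! The contradiction comes from dilating the lattice. At volume 1 a Gabor frame is also a Riesz
sequence (`riesz_of_frame`). If V_g g decays faster than |z|^{-2d}, the Gram matrix has summable
off-diagonal decay, and the lower Riesz bound survives replacing Λ by αΛ for α < 1 close to 1
(`eventually_riesz_dilate`). But a Riesz sequence over a lattice forces volume at least 1
(`one_le_of_riesz`), while αΛ has volume α^{2d} < 1.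

Both density statements rest on Moyal's identity. Integrated over a fundamental cell, it shows that
the frame generator g and its canonical dual h satisfy Re⟨g, h⟩ = 1 at volume 1, which forces
biorthogonality. Integrated over phase space, it says that a subspace of dimension n occupies
phase-space volume n. The span of a large box of shifts therefore fits into a slightly larger box
only if the lattice is not too dense.

For stability, the norm of a combination is averaged over its restrictions to all translates of one
fixed box. Pairs of indices cut by box boundaries cost little, by summability of the Gram decay. On
one box only finitely many vectors move under dilation, and covariance carries the resulting bound
to every translate.

Only covariance up to phase, strong continuity and Moyal's identity are used, and `IsMoyalSystem`
records exactly these. -/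

open FourierTransform SchwartzMap in
/-- On `L¹ ∩ L²` the Fourier transform on `L²` is given by the Fourier integral. -/
theorem fourier_toLp_ae_eq {f : E → ℂ} (h1 : Integrable f) (h2 : MemLp f 2) :
    (𝓕 (h2.toLp f) : Lp ℂ 2 (volume : Measure E)) =ᵐ[volume] 𝓕 f := by
  refine ae_eq_of_integral_contDiff_smul_eq ?_ ?_ ?_
  · exact (Lp.memLp _).locallyIntegrable (by norm_num)
  · refine Continuous.locallyIntegrable ?_
    exact VectorFourier.fourierIntegral_continuous Real.continuous_fourierChar
      (by exact continuous_inner) h1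
  · intro φ hφ hφc
    have hψc : HasCompactSupport (fun x => (φ x : ℂ)) := hφc.comp_left (g := Complex.ofReal) (by simp)
    have hψ : ContDiff ℝ (↑(⊤ : ℕ∞)) (fun x => (φ x : ℂ)) := Complex.ofRealCLM.contDiff.comp hφ
    set ψ : 𝓢(E, ℂ) := hψc.toSchwartzMap hψ
    have hψx : ∀ x, ψ x = φ x := fun x => rfl
    -- Both sides pair equally with test functions: the L² transform because it agrees with the
    -- distributional one, the Fourier integral by Fubini.
    have key := congrArg (fun T => T ψ) (Lp.fourier_toTemperedDistribution_eq (h2.toLp f))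
    simp only [TemperedDistribution.fourier_apply, Lp.toTemperedDistribution_apply] at key
    have e1 : ∀ h : E → ℂ, ∫ x, φ x • h x = ∫ x, ψ x • h x := by
      intro h
      refine integral_congr_ae (Eventually.of_forall fun x => ?_)
      simp [hψx]
    rw [e1, e1, ← key]
    have e2 : ∫ x, (𝓕 ψ) x • (h2.toLp f) x = ∫ x, (𝓕 ψ) x • f x := by
      refine integral_congr_ae ?_
      filter_upwards [h2.coeFn_toLp] with x hx
      rw [hx]
    rw [e2]
    have := VectorFourier.integral_fourierIntegral_smul_eq_flip (μ := volume) (ν := volume)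
      (L := innerₗ E) (f := ψ) (g := f) Real.continuous_fourierChar continuous_inner
      ψ.integrable h1
    rw [flip_innerₗ] at this
    exact this

open FourierTransform in
/-- Plancherel's theorem for the Fourier integral on `L¹ ∩ L²`. -/
theorem lintegral_enorm_fourier_sq {f : E → ℂ} (h1 : Integrable f) (h2 : MemLp f 2) :
    ∫⁻ x, ‖𝓕 f x‖ₑ ^ 2 = ∫⁻ x, ‖f x‖ₑ ^ 2 := by
  have key : ‖(𝓕 (h2.toLp f) : Lp ℂ 2 (volume : Measure E))‖ₑ = ‖h2.toLp f‖ₑ := by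
    rw [← ofReal_norm, ← ofReal_norm, Lp.norm_fourier_eq]
  rw [Lp.enorm_def, Lp.enorm_def, eLpNorm_congr_ae (fourier_toLp_ae_eq h1 h2),
    eLpNorm_congr_ae h2.coeFn_toLp] at key
  have e : ∀ h : E → ℂ, ∫⁻ x, ‖h x‖ₑ ^ 2 = (eLpNorm h 2 volume) ^ 2 := by
    intro h
    have := eLpNorm_nnreal_pow_eq_lintegral (f := h) (μ := volume) (p := 2) (by norm_num)
    simp only [NNReal.coe_ofNat, ENNReal.rpow_ofNat, ENNReal.coe_ofNat] at this
    exact this.symm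
  rw [e, e, key]

end Plancherel

/-! ### Time-frequency shifts: isometry, composition law, strong continuity. -/

section TimeFrequency

variable {d : ℕ}

@[simp] theorem position_add (z w : PhaseSpace d) : position (z + w) = position z + position w := rfl

@[simp] theorem frequency_add (z w : PhaseSpace d) :
    frequency (z + w) = frequency z + frequency w := rfl

theorem continuous_position : Continuous (position : PhaseSpace d → Space d) := by
  unfold position; fun_prop

theorem continuous_frequency : Continuous (frequency : PhaseSpace d → Space d) := by
  unfold frequency; fun_prop

/-- The point `(x, ξ)` of phase space. -/
def phasePoint (x ξ : Space d) : PhaseSpace d := WithLp.toLp 2 (Sum.elim x ξ)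

@[simp] theorem position_phasePoint (x ξ : Space d) : position (phasePoint x ξ) = x := rfl

@[simp] theorem frequency_phasePoint (x ξ : Space d) : frequency (phasePoint x ξ) = ξ := rfl

/-- The unimodular function `t ↦ e^{2π i ξ · t}`. -/
noncomputable def character (ξ t : Space d) : ℂ :=
  Complex.exp (2 * Real.pi * Complex.I * (inner ℝ ξ t : ℝ))

theorem character_eq (ξ t : Space d) :
    character ξ t = Complex.exp (((2 * Real.pi * inner ℝ ξ t : ℝ) : ℂ) * Complex.I) := by
  unfold character; congr 1; push_cast; ring

@[simp] theorem norm_character (ξ t : Space d) : ‖character ξ t‖ = 1 := by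
  rw [character_eq, Complex.norm_exp_ofReal_mul_I]

theorem character_add_left (ξ η t : Space d) :
    character (ξ + η) t = character ξ t * character η t := by
  simp only [character, ← Complex.exp_add, inner_add_left]; congr 1; push_cast; ring

theorem character_add_right (ξ t s : Space d) :
    character ξ (t + s) = character ξ t * character ξ s := by
  simp only [character, ← Complex.exp_add, inner_add_right]; congr 1; push_cast; ring

@[simp] theorem character_zero_left (t : Space d) : character 0 t = 1 := by simp [character]

theorem tfShiftFun_apply (z : PhaseSpace d) (f : Space d → ℂ) (t : Space d) :
    tfShiftFun z f t = character (frequency z) t * f (t - position z) := rfl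

theorem coeFn_tfShift (z : PhaseSpace d) (f : L2 d) : tfShift z f =ᵐ[volume] tfShiftFun z f :=
  MemLp.coeFn_toLp _

theorem quasiMeasurePreserving_sub (x : Space d) :
    Measure.QuasiMeasurePreserving (fun t : Space d => t - x) volume volume :=
  (measurePreserving_sub_right volume x).quasiMeasurePreserving

theorem norm_tfShift (z : PhaseSpace d) (f : L2 d) : ‖tfShift z f‖ = ‖f‖ := by
  rw [Lp.norm_def, Lp.norm_def, eLpNorm_congr_ae (coeFn_tfShift z f)]
  congr 1
  rw [← eLpNorm_comp_measurePreserving (Lp.aestronglyMeasurable f)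
    (measurePreserving_sub_right volume (position z))]
  exact eLpNorm_congr_norm_ae (Eventually.of_forall fun t => by simp [tfShiftFun_apply])

/-- The time-frequency shift as a linear isometry of `L²(ℝ^d)`. -/
noncomputable def tfShiftₗᵢ (z : PhaseSpace d) : L2 d →ₗᵢ[ℂ] L2 d where
  toFun := tfShift z
  map_add' f g := by
    apply Lp.ext
    filter_upwards [coeFn_tfShift z (f + g), Lp.coeFn_add (tfShift z f) (tfShift z g),
      coeFn_tfShift z f, coeFn_tfShift z g,
      (quasiMeasurePreserving_sub (position z)).ae (Lp.coeFn_add f g)] with t h1 h2 h3 h4 h5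
    simp only [h1, h2, Pi.add_apply, h3, h4, tfShiftFun_apply] at h5 ⊢
    rw [h5, mul_add]
  map_smul' c f := by
    apply Lp.ext
    filter_upwards [coeFn_tfShift z (c • f), Lp.coeFn_smul c (tfShift z f), coeFn_tfShift z f,
      (quasiMeasurePreserving_sub (position z)).ae (Lp.coeFn_smul c f)] with t h1 h2 h3 h4
    simp only [RingHom.id_apply, h1, h2, Pi.smul_apply, h3, tfShiftFun_apply, smul_eq_mul] at h4 ⊢
    rw [h4, mul_left_comm]
  norm_map' := norm_tfShift z

@[simp] theorem tfShiftₗᵢ_apply (z : PhaseSpace d) (f : L2 d) : tfShiftₗᵢ z f = tfShift z f := rfl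

theorem tfShift_tfShift (z w : PhaseSpace d) (f : L2 d) :
    tfShift z (tfShift w f) = character (frequency w) (-position z) • tfShift (z + w) f := by
  apply Lp.ext
  filter_upwards [coeFn_tfShift z (tfShift w f), coeFn_tfShift (z + w) f,
    (quasiMeasurePreserving_sub (position z)).ae (coeFn_tfShift w f),
    Lp.coeFn_smul (character (frequency w) (-position z)) (tfShift (z + w) f)] with t h1 h2 h3 h4
  simp only [h4, Pi.smul_apply, h1, h2, tfShiftFun_apply, smul_eq_mul] at h3 ⊢
  rw [h3, frequency_add, position_add, character_add_left, sub_eq_add_neg t, character_add_right,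
    show t + -position z - position w = t - (position z + position w) by abel]
  ring

theorem continuous_tfShift_translation (f : L2 d) :
    Continuous fun x : Space d => tfShift (phasePoint x 0) f := by
  let F : Space d → C(Space d, Space d) := fun x => ⟨fun t => t - x, by fun_prop⟩
  have hF : Continuous F := by
    refine ContinuousMap.continuous_of_continuous_uncurry _ ?_
    exact continuous_snd.sub continuous_fst
  have hm : ∀ x, MeasurePreserving (F x) volume volume := fun x =>
    measurePreserving_sub_right volume x
  have := (continuous_const (y := f)).compMeasurePreservingLp (p := 2) hF hm (by norm_num)
  convert this using 2 with x
  apply Lp.ext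
  filter_upwards [coeFn_tfShift (phasePoint x 0) f, Lp.coeFn_compMeasurePreserving f (hm x)]
    with t h1 h2
  rw [h1, h2, tfShiftFun_apply]
  simp [F]

theorem enorm_sq_eq_lintegral (f : L2 d) : ‖f‖ₑ ^ 2 = ∫⁻ t, ‖f t‖ₑ ^ 2 := by
  have := eLpNorm_nnreal_pow_eq_lintegral (f := f) (μ := volume) (p := 2) (by norm_num)
  simp only [NNReal.coe_ofNat, ENNReal.rpow_ofNat, ENNReal.coe_ofNat] at this
  rw [Lp.enorm_def, this]

theorem continuous_character : Continuous fun p : Space d × Space d => character p.1 p.2 := by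
  unfold character; fun_prop

theorem continuous_tfShift_modulation (f : L2 d) :
    Continuous fun ξ : Space d => tfShift (phasePoint 0 ξ) f := by
  rw [continuous_iff_continuousAt]
  intro ξ₀
  rw [ContinuousAt, tendsto_iff_edist_tendsto_0]
  have key : ∀ ξ, edist (tfShift (phasePoint 0 ξ) f) (tfShift (phasePoint 0 ξ₀) f) ^ 2 =
      ∫⁻ t, ‖(character ξ t - character ξ₀ t) * f t‖ₑ ^ 2 := by
    intro ξ
    rw [edist_eq_enorm_sub, enorm_sq_eq_lintegral]
    refine lintegral_congr_ae ?_
    filter_upwards [coeFn_tfShift (phasePoint 0 ξ) f, coeFn_tfShift (phasePoint 0 ξ₀) f,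
      Lp.coeFn_sub (tfShift (phasePoint 0 ξ) f) (tfShift (phasePoint 0 ξ₀) f)] with t h1 h2 h3
    simp only [h3, Pi.sub_apply, h1, h2, tfShiftFun_apply, position_phasePoint, sub_zero,
      frequency_phasePoint, sub_mul]
  have lim : Tendsto (fun ξ => ∫⁻ t, ‖(character ξ t - character ξ₀ t) * f t‖ₑ ^ 2) (𝓝 ξ₀)
      (𝓝 (∫⁻ _ : Space d, 0)) := by
    refine tendsto_lintegral_filter_of_dominated_convergence (fun t => 4 * ‖f t‖ₑ ^ 2) ?_ ?_ ?_ ?_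
    · refine Eventually.of_forall fun ξ => ?_
      have h1 : Measurable fun t : Space d => character ξ t - character ξ₀ t := by
        refine (Continuous.measurable ?_)
        exact (continuous_character.comp (Continuous.prodMk_right ξ)).sub
          (continuous_character.comp (Continuous.prodMk_right ξ₀))
      exact ((h1.mul (Lp.stronglyMeasurable f).measurable).enorm.pow_const 2)
    · refine Eventually.of_forall fun ξ => Eventually.of_forall fun t => ?_
      rw [enorm_mul, mul_pow]
      gcongr
      calc ‖character ξ t - character ξ₀ t‖ₑ ^ 2 ≤ (‖character ξ t‖ₑ + ‖character ξ₀ t‖ₑ) ^ 2 := by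
            gcongr; exact enorm_sub_le
        _ = 4 := by
            rw [← ofReal_norm, ← ofReal_norm, norm_character, norm_character]; norm_num
    · rw [lintegral_const_mul' _ _ (by norm_num), ← enorm_sq_eq_lintegral]
      exact ENNReal.mul_ne_top (by norm_num) (by finiteness)
    · refine Eventually.of_forall fun t => ?_
      have : ContinuousAt (fun ξ => ‖(character ξ t - character ξ₀ t) * f t‖ₑ ^ 2) ξ₀ := by
        have : Continuous (fun ξ => (character ξ t - character ξ₀ t) * f t) :=
          ((continuous_character.comp (Continuous.prodMk_left t)).sub continuous_const).mul
            continuous_const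
        exact ((ENNReal.continuous_pow 2).comp this.enorm).continuousAt
      simpa [ContinuousAt] using this
  rw [lintegral_zero, ← funext key] at lim
  have := (ENNReal.continuous_rpow_const (y := 1 / 2)).continuousAt.tendsto.comp lim
  have e : ∀ x : ℝ≥0∞, (x ^ 2) ^ (1 / 2 : ℝ) = x := fun x => by
    rw [← ENNReal.rpow_natCast, ← ENNReal.rpow_mul]; norm_num
  rw [ENNReal.zero_rpow_of_pos (by norm_num)] at this
  simpa only [Function.comp_def, e] using this

theorem tfShift_eq_modulation_translation (z : PhaseSpace d) (f : L2 d) :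
    tfShift z f = tfShift (phasePoint 0 (frequency z)) (tfShift (phasePoint (position z) 0) f) := by
  rw [tfShift_tfShift]
  have : phasePoint 0 (frequency z) + phasePoint (position z) 0 = z := by
    ext i
    rcases i with i | i <;> simp [phasePoint, position, frequency]
  rw [this]
  simp

/-- Since modulations are isometries, continuity of translations at f and of modulations at the
single vector h = T_{x₀} f suffices; no joint estimate is needed. -/
theorem continuous_tfShift (f : L2 d) : Continuous fun z : PhaseSpace d => tfShift z f := by
  rw [continuous_iff_continuousAt]
  intro z₀
  rw [ContinuousAt, tendsto_iff_norm_sub_tendsto_zero]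
  have h1 : Tendsto (fun z => ‖tfShift (phasePoint (position z) 0) f -
      tfShift (phasePoint (position z₀) 0) f‖) (𝓝 z₀) (𝓝 0) := by
    rw [← tendsto_iff_norm_sub_tendsto_zero]
    exact ((continuous_tfShift_translation f).comp continuous_position).continuousAt
  set h := tfShift (phasePoint (position z₀) 0) f
  have h2 : Tendsto (fun z => ‖tfShift (phasePoint 0 (frequency z)) h -
      tfShift (phasePoint 0 (frequency z₀)) h‖) (𝓝 z₀) (𝓝 0) := by
    rw [← tendsto_iff_norm_sub_tendsto_zero]
    exact ((continuous_tfShift_modulation h).comp continuous_frequency).continuousAt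
  refine squeeze_zero (fun _ => norm_nonneg _) (fun z => ?_) (by simpa using h1.add h2)
  rw [tfShift_eq_modulation_translation z f, tfShift_eq_modulation_translation z₀ f]
  refine (norm_sub_le_norm_sub_add_norm_sub _ (tfShift (phasePoint 0 (frequency z)) h) _).trans ?_
  refine add_le_add (le_of_eq ?_) le_rfl
  simp only [← tfShiftₗᵢ_apply, ← map_sub, LinearIsometry.norm_map]

end TimeFrequency

/-! ### Moyal's identity. -/

section TimeFrequency

variable {d : ℕ}

theorem measurePreserving_position_frequency :
    MeasurePreserving (fun z : PhaseSpace d => (position z, frequency z))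
      volume (volume.prod volume) :=
  ((PiLp.volume_preserving_toLp (Fin d)).prod (PiLp.volume_preserving_toLp (Fin d))).comp
    ((volume_measurePreserving_sumPiEquivProdPi fun _ : Fin d ⊕ Fin d => ℝ).comp
      (PiLp.volume_preserving_ofLp (Fin d ⊕ Fin d)))

theorem inner_tfShift_eq_stft (z : PhaseSpace d) (g f : L2 d) :
    inner ℂ (tfShift z g) f = stft g f z := by
  rw [L2.inner_def, stft]
  refine integral_congr_ae ?_
  filter_upwards [coeFn_tfShift z g] with t h
  rw [h, tfShiftFun_apply, RCLike.inner_apply, map_mul, character, ← Complex.exp_conj,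
    mul_comm (Complex.exp _), ← mul_assoc]
  have h2 : (starRingEnd ℂ) (2 : ℂ) = 2 := Complex.conj_ofNat 2
  simp [Complex.conj_ofReal, h2, mul_assoc]

theorem inner_tfShift (z : PhaseSpace d) (g f : L2 d) :
    inner ℂ (tfShift z g) f = FourierTransform.fourier
      (fun t => f t * conj (g (t - position z))) (frequency z) := by
  rw [inner_tfShift_eq_stft, Real.fourier_eq', stft]
  refine integral_congr_ae (Eventually.of_forall fun t => ?_)
  simp only [smul_eq_mul]
  rw [mul_comm]
  congr 2
  push_cast
  rw [real_inner_comm]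
  ring

theorem memLp_conj_translate (g : L2 d) (x : Space d) :
    MemLp (fun t => conj (g (t - x))) 2 (volume : Measure (Space d)) :=
  ((Lp.memLp g).comp_measurePreserving (measurePreserving_sub_right volume x)).star

theorem integrable_mul_conj_translate (g f : L2 d) (x : Space d) :
    Integrable fun t => f t * conj (g (t - x)) :=
  (Lp.memLp f).integrable_mul (memLp_conj_translate g x)

theorem memLp_mul_conj_translate (g f : L2 d) (hf : MemLp f ∞) (x : Space d) :
    MemLp (fun t => f t * conj (g (t - x))) 2 (volume : Measure (Space d)) :=
  (memLp_conj_translate g x).mul' hf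

/-- Moyal's identity, for a bounded `f`. -/
theorem lintegral_enorm_inner_tfShift_sq (g f : L2 d) (hf : MemLp f ∞) :
    ∫⁻ z : PhaseSpace d, ‖inner ℂ (tfShift z g) f‖ₑ ^ 2 = ‖f‖ₑ ^ 2 * ‖g‖ₑ ^ 2 := by
  set G : Space d × Space d → ℝ≥0∞ := fun p => ‖inner ℂ (tfShift (phasePoint p.1 p.2) g) f‖ₑ ^ 2
  have hpt : ∀ z : PhaseSpace d, phasePoint (position z) (frequency z) = z := by
    intro z
    ext i
    rcases i with i | i <;> rfl
  have hcont : Continuous fun p : Space d × Space d => phasePoint p.1 p.2 := by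
    unfold phasePoint
    refine (PiLp.continuous_toLp 2 _).comp (continuous_pi fun i => ?_)
    rcases i with i | i <;> simp only [Sum.elim_inl, Sum.elim_inr] <;> fun_prop
  have hG : Measurable G := by
    refine Continuous.measurable ((ENNReal.continuous_pow 2).comp (Continuous.enorm ?_))
    exact ((continuous_tfShift g).comp hcont).inner continuous_const
  have h1 : ∫⁻ z : PhaseSpace d, ‖inner ℂ (tfShift z g) f‖ₑ ^ 2 =
      ∫⁻ p, G p ∂(volume.prod volume) := by
    rw [← measurePreserving_position_frequency.lintegral_comp hG]
    simp only [G, hpt]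
  -- For fixed x the inner product is a Fourier transform in ξ. Boundedness of f puts the
  -- transformed product in L² for every x, so Plancherel applies on each fibre.
  have h2 : ∀ x : Space d, ∫⁻ ξ, G (x, ξ) = ∫⁻ t, ‖f t‖ₑ ^ 2 * ‖g (t - x)‖ₑ ^ 2 := by
    intro x
    simp only [G, inner_tfShift, position_phasePoint, frequency_phasePoint]
    rw [lintegral_enorm_fourier_sq (integrable_mul_conj_translate g f x)
      (memLp_mul_conj_translate g f hf x)]
    refine lintegral_congr fun t => ?_
    rw [enorm_mul, mul_pow]
    congr 2
    rw [← ofReal_norm, ← ofReal_norm, RCLike.norm_conj]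
  have hfm : Measurable f := (Lp.stronglyMeasurable f).measurable
  have hgm : Measurable g := (Lp.stronglyMeasurable g).measurable
  rw [h1, lintegral_prod _ hG.aemeasurable]
  simp only [h2]
  rw [lintegral_lintegral_swap (by fun_prop)]
  have h3 : ∀ t, ∫⁻ x : Space d, ‖f t‖ₑ ^ 2 * ‖g (t - x)‖ₑ ^ 2 = ‖f t‖ₑ ^ 2 * ‖g‖ₑ ^ 2 := by
    intro t
    rw [lintegral_const_mul _ (by fun_prop), lintegral_sub_left_eq_self (fun y => ‖g y‖ₑ ^ 2),
      ← enorm_sq_eq_lintegral]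
  simp only [h3]
  rw [lintegral_mul_const _ (by fun_prop), ← enorm_sq_eq_lintegral]

/-- Supplies the test window f₀; the identity above is available only for bounded ones. -/
theorem exists_bounded_norm_eq_one (d : ℕ) : ∃ f : L2 d, MemLp f ∞ ∧ ‖f‖ = 1 := by
  have hμ : volume (Metric.ball (0 : Space d) 1) ≠ ∞ := measure_ball_lt_top.ne
  set f : L2 d := indicatorConstLp 2 measurableSet_ball hμ 1
  have hf : MemLp f ∞ :=
    (memLp_congr_ae indicatorConstLp_coeFn).2 (memLp_indicator_const ∞ measurableSet_ball _
      (Or.inr hμ))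
  have hn : ‖f‖ ≠ 0 := by
    rw [norm_indicatorConstLp (by norm_num) (by norm_num), norm_one, one_mul]
    refine (Real.rpow_pos_of_pos ?_ _).ne'
    exact ENNReal.toReal_pos (Metric.measure_ball_pos volume _ one_pos).ne' hμ
  refine ⟨((‖f‖⁻¹ : ℝ) : ℂ) • f, ?_, ?_⟩
  · exact (memLp_congr_ae (Lp.coeFn_smul _ f)).2 (hf.const_smul _)
  · rw [norm_smul, Complex.norm_real, norm_inv, norm_norm, inv_mul_cancel₀ hn]

end TimeFrequency

/-! ### Frame operators. -/

section FrameOperator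

variable {H : Type*} [NormedAddCommGroup H] [InnerProductSpace ℂ H] [CompleteSpace H]

/-- The frame operator of a frame and its inverse. -/
theorem exists_frameOperator {K : Type*} (e : K → H) {a b : ℝ} (ha : 0 < a) (hb : 0 < b)
    (he : ∀ f : H, ENNReal.ofReal (a * ‖f‖ ^ 2) ≤ ∑' k, ENNReal.ofReal (‖inner ℂ (e k) f‖ ^ 2) ∧
      ∑' k, ENNReal.ofReal (‖inner ℂ (e k) f‖ ^ 2) ≤ ENNReal.ofReal (b * ‖f‖ ^ 2)) :
    ∃ S R : H →L[ℂ] H, (∀ x y, HasSum (fun k => conj (inner ℂ (e k) x) * inner ℂ (e k) y)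
        (inner ℂ (S x) y)) ∧ (∀ x, S (R x) = x) ∧ (∀ x, R (S x) = x) ∧
      ∀ x, a * ‖x‖ ^ 2 ≤ (inner ℂ (S x) x : ℂ).re := by
  have hsum : ∀ f, Summable fun k => ‖inner ℂ (e k) f‖ ^ 2 := fun f =>
    (ENNReal.summable_toReal ((he f).2.trans_lt ENNReal.ofReal_lt_top).ne).congr
      fun k => ENNReal.toReal_ofReal (by positivity)
  have htsum : ∀ f, ∑' k, ENNReal.ofReal (‖inner ℂ (e k) f‖ ^ 2) =
      ENNReal.ofReal (∑' k, ‖inner ℂ (e k) f‖ ^ 2) := fun f =>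
    (ENNReal.ofReal_tsum_of_nonneg (fun k => by positivity) (hsum f)).symm
  have hmem : ∀ f, Memℓp (fun k => (inner ℂ (e k) f : ℂ)) 2 := fun f => by
    rw [memℓp_gen_iff (by norm_num)]
    simpa using hsum f
  let C₀ : H →ₗ[ℂ] lp (fun _ : K => ℂ) 2 :=
    { toFun := fun f => ⟨fun k => inner ℂ (e k) f, hmem f⟩
      map_add' := fun x y => lp.ext (funext fun k => inner_add_right _ _ _)
      map_smul' := fun c x => lp.ext (funext fun k => inner_smul_right _ _ _) }
  have hC₀ : ∀ f, ‖C₀ f‖ ^ 2 = ∑' k, ‖inner ℂ (e k) f‖ ^ 2 := fun f => by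
    have := lp.norm_rpow_eq_tsum (p := 2) (by norm_num) (C₀ f)
    simp only [ENNReal.toReal_ofNat, Real.rpow_ofNat] at this
    exact this
  let C : H →L[ℂ] lp (fun _ : K => ℂ) 2 := C₀.mkContinuous (Real.sqrt b) fun f => by
    refine abs_le_of_sq_le_sq' ?_ (by positivity) |>.2
    rw [mul_pow, hC₀]
    have h := (he f).2
    rw [htsum] at h
    rw [Real.sq_sqrt hb.le]
    exact (ENNReal.ofReal_le_ofReal_iff (by positivity)).1 h
  have hCn : ∀ f, a * ‖f‖ ^ 2 ≤ ‖C f‖ ^ 2 := fun f => by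
    have h := (he f).1
    rw [htsum, ← hC₀] at h
    exact (ENNReal.ofReal_le_ofReal_iff (by positivity)).1 h
  -- S = C*C for the analysis operator C; the lower frame bound makes S coercive, hence invertible.
  set S : H →L[ℂ] H := (ContinuousLinearMap.adjoint C).comp C
  have hS : ∀ x y, inner ℂ (S x) y = inner ℂ (C x) (C y) := fun x y =>
    ContinuousLinearMap.adjoint_inner_left C y (C x)
  have hSre : ∀ x, (inner ℂ (S x) x : ℂ).re = ‖C x‖ ^ 2 := fun x => by
    rw [hS, inner_self_eq_norm_sq_to_K]; norm_cast
  have hunit : IsUnit S := by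
    refine ContinuousLinearMap.isUnit_of_forall_le_norm_inner_map S (c := ⟨a, ha.le⟩) ha fun x => ?_
    calc ‖x‖ ^ 2 * a ≤ ‖C x‖ ^ 2 := by rw [mul_comm]; exact hCn x
      _ = (inner ℂ (S x) x : ℂ).re := (hSre x).symm
      _ ≤ _ := Complex.re_le_norm _
  obtain ⟨V, hV⟩ := hunit
  refine ⟨S, (V⁻¹ : (H →L[ℂ] H)ˣ), fun x y => ?_, fun x => ?_, fun x => ?_, fun x => ?_⟩
  · rw [hS]
    have := lp.hasSum_inner (𝕜 := ℂ) (C x) (C y)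
    simp only [RCLike.inner_apply] at this
    refine this.congr_fun fun k => mul_comm _ _
  · rw [← hV]; exact DFunLike.congr_fun V.mul_inv x
  · rw [← hV]; exact DFunLike.congr_fun V.inv_mul x
  · rw [hSre]; exact hCn x

end FrameOperator

/-! ### Periodization over the integer lattice. -/

section Periodization

variable {ι : Type*}

/-- The integer vector `k`, as a real vector. -/
def intVec (k : ι → ℤ) : ι → ℝ := fun i => k i

@[simp] theorem intVec_apply (k : ι → ℤ) (i : ι) : intVec k i = k i := rfl

theorem intVec_sub (k l : ι → ℤ) : intVec (k - l) = intVec k - intVec l := by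
  ext i; simp

@[simp] theorem intVec_zero : intVec (0 : ι → ℤ) = 0 := by ext i; simp

/-- The half-open unit cube. -/
def unitCube (ι : Type*) : Set (ι → ℝ) := Set.pi Set.univ fun _ => Set.Ico 0 1

variable [Fintype ι]

theorem measurableSet_unitCube : MeasurableSet (unitCube ι) :=
  MeasurableSet.univ_pi fun _ => measurableSet_Ico

theorem volume_unitCube : volume (unitCube ι) = 1 := by
  simp [unitCube, Real.volume_pi_Ico]

theorem lintegral_eq_setLIntegral_unitCube_tsum {Φ : (ι → ℝ) → ℝ≥0∞} (hΦ : Measurable Φ) :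
    ∫⁻ u, Φ u = ∫⁻ u in unitCube ι, ∑' k : ι → ℤ, Φ (u + intVec k) := by
  set P : (ι → ℤ) → Set (ι → ℝ) := fun k => {u | u - intVec k ∈ unitCube ι}
  have hPmem : ∀ k u, u ∈ P k ↔ ∀ i, ⌊u i⌋ = k i := fun k u => by
    simp only [P, unitCube, Set.mem_ofPred_eq, Set.mem_pi, Set.mem_univ, true_imp_iff, Set.mem_Ico,
      Pi.sub_apply, intVec_apply, Int.floor_eq_iff]
    refine forall_congr' fun i => ⟨fun h => ⟨by linarith, by linarith⟩,
      fun h => ⟨by linarith, by linarith⟩⟩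
  have hPm : ∀ k, MeasurableSet (P k) := fun k =>
    measurableSet_unitCube.preimage (measurable_id.sub_const _)
  have hunion : ⋃ k, P k = Set.univ := Set.eq_univ_of_forall fun u =>
    Set.mem_iUnion.2 ⟨fun i => ⌊u i⌋, (hPmem _ _).2 fun _ => rfl⟩
  have hdisj : Pairwise (Function.onFun Disjoint P) := fun k l hkl =>
    Set.disjoint_left.2 fun u hk hl => hkl <| funext fun i =>
      ((hPmem _ _).1 hk i).symm.trans ((hPmem _ _).1 hl i)
  rw [← setLIntegral_univ, ← hunion, lintegral_iUnion hPm hdisj, lintegral_tsum]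
  · refine tsum_congr fun k => ?_
    have h := (measurePreserving_sub_right (volume : Measure (ι → ℝ)) (intVec k)
      ).setLIntegral_comp_preimage measurableSet_unitCube (f := fun u => Φ (u + intVec k))
      (hΦ.comp (measurable_id.add_const _))
    simp only [sub_add_cancel] at h
    exact h
  · exact fun k => (hΦ.comp (measurable_id.add_const _)).aemeasurable

end Periodization

/-! ### Moyal systems; a frame at critical density is a Riesz sequence. -/

section MoyalSystem

variable {ι : Type*} [Fintype ι] {H : Type*} [NormedAddCommGroup H] [InnerProductSpace ℂ H]

/-- A projective representation `U` of `ℝ^ι` by linear isometries, together with a unit vector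
`f₀` for which the orthogonality relation `κ ∫ |⟨U u g, f₀⟩|² du = ‖g‖²` holds. -/
structure IsMoyalSystem (U : (ι → ℝ) → H →ₗᵢ[ℂ] H) (κ : ℝ) (f₀ : H) : Prop where
  comp : ∀ u v, ∃ c : ℂ, ‖c‖ = 1 ∧ ∀ x, U u (U v x) = c • U (u + v) x
  continuous : ∀ x, Continuous fun u => U u x
  norm_window : ‖f₀‖ = 1
  lintegral_eq : ∀ g, ENNReal.ofReal κ * ∫⁻ u, ‖inner ℂ (U u g) f₀‖ₑ ^ 2 = ‖g‖ₑ ^ 2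

namespace IsMoyalSystem

variable {U : (ι → ℝ) → H →ₗᵢ[ℂ] H} {κ : ℝ} {f₀ : H}

theorem apply_zero (hU : IsMoyalSystem U κ f₀) : ∃ c : ℂ, ‖c‖ = 1 ∧ ∀ x, U 0 x = c • x := by
  obtain ⟨c, hc, h⟩ := hU.comp 0 0
  refine ⟨c, hc, fun x => (U 0).injective ?_⟩
  rw [h, add_zero, map_smul]

theorem apply_eq_smul (hU : IsMoyalSystem U κ f₀) (u v : ι → ℝ) :
    ∃ c : ℂ, ‖c‖ = 1 ∧ ∀ x, U v x = c • U u (U (v - u) x) := by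
  obtain ⟨c, hc, h⟩ := hU.comp u (v - u)
  have hc0 : c ≠ 0 := fun h0 => by simp [h0] at hc
  refine ⟨c⁻¹, by simp [hc], fun x => ?_⟩
  rw [h, smul_smul, inv_mul_cancel₀ hc0, one_smul, add_sub_cancel]

theorem surjective (hU : IsMoyalSystem U κ f₀) (u : ι → ℝ) : Function.Surjective (U u) := by
  intro y
  obtain ⟨c, hc, h⟩ := hU.apply_eq_smul u 0
  obtain ⟨c', hc', h'⟩ := hU.apply_zero
  have hc0 : c' ≠ 0 := fun h0 => by simp [h0] at hc'
  refine ⟨(c'⁻¹ * c) • U (0 - u) y, ?_⟩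
  rw [map_smul, mul_smul, ← h, h', smul_smul, inv_mul_cancel₀ hc0, one_smul]

theorem norm_inner_apply_zero (hU : IsMoyalSystem U κ f₀) (x y : H) :
    ‖inner ℂ (U 0 x) y‖ = ‖inner ℂ x y‖ := by
  obtain ⟨c, hc, h⟩ := hU.apply_zero
  rw [h, inner_smul_left, norm_mul, RCLike.norm_conj, hc, one_mul]

theorem norm_inner_apply (hU : IsMoyalSystem U κ f₀) (u v : ι → ℝ) (x y : H) :
    ‖inner ℂ (U u x) (U v y)‖ = ‖inner ℂ (U (u - v) x) y‖ := by
  obtain ⟨c, hc, h⟩ := hU.apply_eq_smul v u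
  rw [h, inner_smul_left, norm_mul, RCLike.norm_conj, hc, one_mul, LinearIsometry.inner_map_map]

theorem measurable_enorm_inner (hU : IsMoyalSystem U κ f₀) (g : H) :
    Measurable fun u => ‖inner ℂ (U u g) f₀‖ₑ ^ 2 :=
  ((ENNReal.continuous_pow 2).comp ((hU.continuous g).inner continuous_const).enorm).measurable

/-- Periodizing the orthogonality relation turns it into an average of frame sums, tested on the
vectors U(-u) f₀. Through this the density κ enters statements about the lattice. -/
theorem setLIntegral_unitCube_tsum (hU : IsMoyalSystem U κ f₀) (g : H) :
    ENNReal.ofReal κ * ∫⁻ u in unitCube ι, ∑' k : ι → ℤ, ‖inner ℂ (U (intVec k) g) (U (-u) f₀)‖ₑ ^ 2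
      = ‖g‖ₑ ^ 2 := by
  rw [← hU.lintegral_eq g,
    lintegral_eq_setLIntegral_unitCube_tsum (hU.measurable_enorm_inner g)]
  congr 1
  refine lintegral_congr fun u => tsum_congr fun k => ?_
  rw [← ofReal_norm, ← ofReal_norm, hU.norm_inner_apply, sub_neg_eq_add, add_comm]

variable [CompleteSpace H]

/-- A frame along `ℤ^ι` at critical density is a Riesz sequence. -/
theorem riesz_of_frame (hU : IsMoyalSystem U 1 f₀) (g : H) {a b : ℝ} (ha : 0 < a) (hb : 0 < b)
    (hg : ∀ f : H, ENNReal.ofReal (a * ‖f‖ ^ 2) ≤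
        ∑' k : ι → ℤ, ENNReal.ofReal (‖inner ℂ (U (intVec k) g) f‖ ^ 2) ∧
      ∑' k : ι → ℤ, ENNReal.ofReal (‖inner ℂ (U (intVec k) g) f‖ ^ 2) ≤
        ENNReal.ofReal (b * ‖f‖ ^ 2))
    (F : Finset (ι → ℤ)) (c : (ι → ℤ) → ℂ) :
    a * ∑ k ∈ F, ‖c k‖ ^ 2 ≤ ‖∑ k ∈ F, c k • U (intVec k) g‖ ^ 2 := by
  obtain ⟨S, R, hS, hSR, hRS, hSa⟩ := exists_frameOperator (fun k : ι → ℤ => U (intVec k) g) ha hb hg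
  have hSself : ∀ x y, inner ℂ (S x) y = inner ℂ x (S y) := fun x y => by
    rw [← inner_conj_symm x]
    refine (hS x y).unique ?_
    have := (hS y x).map (starRingEnd ℂ) Complex.continuous_conj
    refine this.congr_fun fun k => ?_
    simp [mul_comm]
  have hRself : ∀ x y, inner ℂ (R x) y = inner ℂ x (R y) := fun x y => by
    conv_lhs => rw [← hSR y, ← hSself, hSR]
  -- Shifting the summation index by j: the phases of the projective representation cancel because
  -- each term pairs a coefficient with a conjugate one.
  have hScov : ∀ (j : ι → ℤ) x, S (U (intVec j) x) = U (intVec j) (S x) := fun j x => by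
    refine ext_inner_right ℂ fun y => ?_
    obtain ⟨y, rfl⟩ := hU.surjective (intVec j) y
    rw [LinearIsometry.inner_map_map]
    refine (hS _ _).unique ?_
    have h := (Equiv.subRight j).hasSum_iff.2 (hS x y)
    refine h.congr_fun fun k => ?_
    obtain ⟨τ, hτ, hτ'⟩ := hU.apply_eq_smul (intVec j) (intVec k)
    simp only [Function.comp_apply, Equiv.subRight_apply, intVec_sub, hτ' g, inner_smul_left,
      LinearIsometry.inner_map_map, map_mul, Complex.conj_conj]
    have : τ * conj τ = 1 := by rw [Complex.mul_conj']; simp [hτ]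
    linear_combination (conj (inner ℂ (U (intVec k - intVec j) g) x) *
      inner ℂ (U (intVec k - intVec j) g) y) * this
  -- The canonical dual generator; as R commutes with the shifts, the dual frame consists of the
  -- shifts of h.
  set h := R g
  have hh : ∀ (k : ι → ℤ) f, inner ℂ (U (intVec k) h) f = inner ℂ (U (intVec k) g) (R f) :=
    fun k f => by
      rw [← hRself]
      congr 1
      rw [← hRS (U (intVec k) h), hScov, hSR]
  have sumg : ∀ f, HasSum (fun k : ι → ℤ => ‖inner ℂ (U (intVec k) g) f‖ ^ 2)
      (inner ℂ (S f) f : ℂ).re := fun f => by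
    refine (Complex.hasSum_re (hS f f)).congr_fun fun k => ?_
    rw [mul_comm, Complex.mul_conj']; norm_cast
  have sumh : ∀ f, HasSum (fun k : ι → ℤ => ‖inner ℂ (U (intVec k) h) f‖ ^ 2)
      (inner ℂ f (R f) : ℂ).re := fun f => by
    have := sumg (R f)
    rw [hSR] at this
    simpa only [hh] using this
  have sumgh : ∀ f, HasSum (fun k : ι → ℤ => (conj (inner ℂ (U (intVec k) g) f) *
      inner ℂ (U (intVec k) h) f : ℂ).re) (‖f‖ ^ 2) := fun f => by
    have := Complex.hasSum_re (hS f (R f))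
    rw [← hRself, hRS, inner_self_eq_norm_sq_to_K] at this
    simp only [hh]
    convert this using 1
    norm_cast
  have expand : ∀ (k : ι → ℤ) f, (‖inner ℂ (U (intVec k) (g + h)) f‖ ^ 2 =
      ‖inner ℂ (U (intVec k) g) f‖ ^ 2 + ‖inner ℂ (U (intVec k) h) f‖ ^ 2 +
        2 * (conj (inner ℂ (U (intVec k) g) f) * inner ℂ (U (intVec k) h) f : ℂ).re) ∧
      ‖inner ℂ (U (intVec k) (g - h)) f‖ ^ 2 =
      ‖inner ℂ (U (intVec k) g) f‖ ^ 2 + ‖inner ℂ (U (intVec k) h) f‖ ^ 2 -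
        2 * (conj (inner ℂ (U (intVec k) g) f) * inner ℂ (U (intVec k) h) f : ℂ).re := by
    intro k f
    rw [map_add, map_sub, inner_add_left, inner_sub_left]
    simp only [Complex.sq_norm, Complex.normSq_apply, Complex.mul_re, Complex.conj_re,
      Complex.conj_im, Complex.add_re, Complex.add_im, Complex.sub_re, Complex.sub_im]
    constructor <;> ring
  have toE : ∀ (x : ℂ), ‖x‖ₑ ^ 2 = ENNReal.ofReal (‖x‖ ^ 2) := fun x => by
    rw [← ofReal_norm, ENNReal.ofReal_pow (norm_nonneg _)]
  have hasSumE : ∀ x f r, HasSum (fun k : ι → ℤ => ‖inner ℂ (U (intVec k) x) f‖ ^ 2) r →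
      ∑' k : ι → ℤ, ‖inner ℂ (U (intVec k) x) f‖ₑ ^ 2 = ENNReal.ofReal r := fun x f r hr => by
    simp only [toE]
    rw [← hr.tsum_eq, ENNReal.ofReal_tsum_of_nonneg (fun k => by positivity) hr.summable]
  -- Polarization of ∑ conj⟨U_k g, f⟩⟨U_k h, f⟩ = ‖f‖², written additively so that it makes sense in
  -- [0, ∞].
  have sumE : ∀ f, ∑' k : ι → ℤ, ‖inner ℂ (U (intVec k) (g + h)) f‖ₑ ^ 2 =
      ∑' k : ι → ℤ, ‖inner ℂ (U (intVec k) (g - h)) f‖ₑ ^ 2 + ENNReal.ofReal (4 * ‖f‖ ^ 2) := by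
    intro f
    have hp := ((sumg f).add (sumh f)).add ((sumgh f).mul_left 2)
    have hm := ((sumg f).add (sumh f)).sub ((sumgh f).mul_left 2)
    simp only [← (expand _ f).1] at hp
    simp only [← (expand _ f).2] at hm
    rw [hasSumE _ _ _ hp, hasSumE _ _ _ hm, ← ENNReal.ofReal_add
      (hm.nonneg fun k => by positivity) (by positivity)]
    congr 1
    ring
  -- Averaging over the unit cell at κ = 1 gives ‖g + h‖² = ‖g - h‖² + 4.
  have hinner : (inner ℂ g h : ℂ).re = 1 := by
    have h1 := hU.setLIntegral_unitCube_tsum (g + h)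
    rw [ENNReal.ofReal_one, one_mul] at h1
    simp only [sumE, LinearIsometry.norm_map, hU.norm_window] at h1
    rw [lintegral_add_right _ measurable_const, setLIntegral_const, volume_unitCube, mul_one] at h1
    have h2 := hU.setLIntegral_unitCube_tsum (g - h)
    rw [ENNReal.ofReal_one, one_mul] at h2
    rw [h2, ← ofReal_norm, ← ofReal_norm, ← ENNReal.ofReal_pow (norm_nonneg _),
      ← ENNReal.ofReal_pow (norm_nonneg _), ← ENNReal.ofReal_add (by positivity) (by positivity),
      ENNReal.ofReal_eq_ofReal_iff (by positivity) (by positivity)] at h1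
    have h3 := @norm_add_sq ℂ H _ _ _ g h
    have h4 := @norm_sub_sq ℂ H _ _ _ g h
    simp only [RCLike.re_to_complex] at h3 h4
    linarith
  have hinner' : 1 ≤ ‖(inner ℂ g h : ℂ)‖ := hinner ▸ Complex.re_le_norm _
  -- The squares |⟨U_k g, h⟩|² sum to Re⟨Sh, h⟩ = Re⟨g, h⟩ = 1, and the term k = 0 is already at
  -- least 1.
  have horth : ∀ k : ι → ℤ, k ≠ 0 → inner ℂ (U (intVec k) g) h = 0 := fun k hk => by
    have h1 := sumg h
    rw [hSR, hinner] at h1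
    have h2 := sum_le_hasSum {0, k} (fun i _ => by positivity) h1
    rw [Finset.sum_pair (Ne.symm hk), intVec_zero, hU.norm_inner_apply_zero] at h2
    have : ‖inner ℂ (U (intVec k) g) h‖ ^ 2 ≤ 0 := by nlinarith
    simpa using this
  set f := ∑ k ∈ F, c k • U (intVec k) g
  -- By biorthogonality the dual shifts read off the coefficients, up to the factor ⟨h, g⟩ of
  -- modulus at least 1.
  have hcoef : ∀ j ∈ F, ‖c j‖ ^ 2 ≤ ‖inner ℂ (U (intVec j) h) f‖ ^ 2 := fun j hj => by
    have h1 : inner ℂ (U (intVec j) h) f = c j * inner ℂ (U (intVec j) h) (U (intVec j) g) := by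
      rw [inner_sum, Finset.sum_eq_single_of_mem j hj, inner_smul_right]
      intro k _ hkj
      rw [inner_smul_right]
      refine mul_eq_zero_of_right _ (norm_eq_zero.1 ?_)
      rw [norm_inner_symm, hU.norm_inner_apply, ← intVec_sub, horth _ (sub_ne_zero.2 hkj), norm_zero]
    rw [h1, norm_mul, LinearIsometry.inner_map_map, norm_inner_symm, mul_pow]
    exact le_mul_of_one_le_right (by positivity) (one_le_pow₀ hinner')
  have h1 : ∑ j ∈ F, ‖c j‖ ^ 2 ≤ (inner ℂ f (R f) : ℂ).re :=
    (Finset.sum_le_sum hcoef).trans (sum_le_hasSum F (fun i _ => by positivity) (sumh f))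
  have h2 : (inner ℂ f (R f) : ℂ).re ≤ ‖f‖ * ‖R f‖ :=
    (Complex.re_le_norm _).trans (norm_inner_le_norm _ _)
  have h3 := hSa (R f)
  rw [hSR] at h3
  have h4 : a * ‖R f‖ ≤ ‖f‖ := by
    rcases (norm_nonneg (R f)).eq_or_lt with h0 | h0
    · rw [← h0, mul_zero]; positivity
    · exact le_of_mul_le_mul_right (by nlinarith) h0
  calc a * ∑ k ∈ F, ‖c k‖ ^ 2 ≤ a * (‖f‖ * ‖R f‖) := by gcongr; exact h1.trans h2
    _ = ‖f‖ * (a * ‖R f‖) := by ring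
    _ ≤ ‖f‖ * ‖f‖ := by gcongr
    _ = ‖f‖ ^ 2 := by ring

end IsMoyalSystem

end MoyalSystem

/-! ### Localizing lower Riesz bounds to boxes. -/

section Localization

variable {ι : Type*} [Fintype ι] [DecidableEq ι]

/-- The integer vectors with coordinates in `{0, …, R - 1}`. -/
noncomputable def box (ι : Type*) [Fintype ι] [DecidableEq ι] (R : ℕ) : Finset (ι → ℤ) :=
  Fintype.piFinset fun _ => Finset.Ico 0 (R : ℤ)

theorem mem_box {R : ℕ} {k : ι → ℤ} : k ∈ box ι R ↔ ∀ i, 0 ≤ k i ∧ k i < R := by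
  simp [box]

theorem card_box (R : ℕ) : (box ι R).card = R ^ Fintype.card ι := by
  simp [box, Fintype.card_piFinset]

/-- The proportion of the box that leaves the box under translation by `-j`. -/
noncomputable def boxDefect (R : ℕ) (j : ι → ℤ) : ℝ :=
  1 - ((box ι R).filter fun q => q - j ∈ box ι R).card / (R : ℝ) ^ Fintype.card ι

theorem boxDefect_nonneg {R : ℕ} (j : ι → ℤ) : 0 ≤ boxDefect R j := by
  have h : (((box ι R).filter fun q => q - j ∈ box ι R).card : ℝ) ≤ (R : ℝ) ^ Fintype.card ι := by
    exact_mod_cast (Finset.card_filter_le _ _).trans_eq (card_box R)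
  exact sub_nonneg.2 (div_le_one_of_le₀ h (by positivity))

theorem boxDefect_le_one (R : ℕ) (j : ι → ℤ) : boxDefect R j ≤ 1 :=
  sub_le_self _ (by positivity)

theorem mul_boxDefect {R : ℕ} (hR : 0 < R) (j : ι → ℤ) :
    (R : ℝ) ^ Fintype.card ι * boxDefect R j = (R : ℝ) ^ Fintype.card ι -
      ((box ι R).filter fun q => q - j ∈ box ι R).card := by
  have : (R : ℝ) ^ Fintype.card ι ≠ 0 := by positivity
  rw [boxDefect]
  field_simp

theorem boxDefect_le {R n : ℕ} (hn : n ≤ R) {j : ι → ℤ} (hj : ∀ i, |j i| ≤ n) :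
    boxDefect R j ≤ 1 - (((R : ℝ) - n) / R) ^ Fintype.card ι := by
  -- In each coordinate an interval of length R - n stays in [0, R) under translation by -j.
  have hsub : (Fintype.piFinset fun i => Finset.Ico (max 0 (j i)) (max 0 (j i) + ((R - n : ℕ) : ℤ))) ⊆
      (box ι R).filter fun q => q - j ∈ box ι R := by
    intro q hq
    simp only [Fintype.mem_piFinset, Finset.mem_Ico] at hq
    simp only [Finset.mem_filter, mem_box, Pi.sub_apply]
    refine ⟨fun i => ?_, fun i => ?_⟩ <;>
    · have h1 := hq i
      have h2 := abs_le.1 (hj i)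
      push_cast [hn] at h1
      omega
  have h := Finset.card_le_card hsub
  simp only [Fintype.card_piFinset, Int.card_Ico, add_sub_cancel_left, Int.toNat_natCast,
    Finset.prod_const, Finset.card_univ] at h
  rw [boxDefect, div_pow]
  gcongr
  rw [← Nat.cast_sub hn]
  exact_mod_cast h

theorem tendsto_boxDefect (j : ι → ℤ) : Tendsto (fun R => boxDefect R j) atTop (𝓝 0) := by
  obtain ⟨n, hn⟩ : ∃ n : ℕ, ∀ i, |j i| ≤ n := by
    refine ⟨∑ i, (j i).natAbs, fun i => ?_⟩
    rw [Int.abs_eq_natAbs]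
    exact_mod_cast Finset.single_le_sum (f := fun i => (j i).natAbs) (fun _ _ => Nat.zero_le _)
      (Finset.mem_univ i)
  refine squeeze_zero' (Eventually.of_forall fun R => boxDefect_nonneg j)
    ((eventually_ge_atTop n).mono fun R hR => boxDefect_le hR hn) ?_
  have h1 : Tendsto (fun R : ℕ => ((R : ℝ) - n) / R) atTop (𝓝 1) := by
    have : Tendsto (fun R : ℕ => 1 - (n : ℝ) / R) atTop (𝓝 (1 - 0)) :=
      tendsto_const_nhds.sub (tendsto_const_div_atTop_nhds_zero_nat _)
    rw [sub_zero] at this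
    refine this.congr' ((eventually_gt_atTop 0).mono fun R hR => ?_)
    have : (R : ℝ) ≠ 0 := by positivity
    field_simp
  simpa using (h1.pow (Fintype.card ι)).const_sub 1

theorem tendsto_tsum_mul_boxDefect {φ : (ι → ℤ) → ℝ} (hφ : Summable φ) (hφ0 : ∀ j, 0 ≤ φ j) :
    Tendsto (fun R => ∑' j, φ j * boxDefect R j) atTop (𝓝 0) := by
  have := tendsto_tsum_of_dominated_convergence (f := fun R j => φ j * boxDefect R j)
    (g := fun _ => 0) (𝓕 := atTop) hφ (fun j => by simpa using (tendsto_boxDefect j).const_mul (φ j))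
    (Eventually.of_forall fun R j => by
      rw [Real.norm_of_nonneg (mul_nonneg (hφ0 j) (boxDefect_nonneg j))]
      exact mul_le_of_le_one_right (hφ0 j) (boxDefect_le_one R j))
  simpa using this

-- Schur's test: x_k x_l ≤ (x_k² + x_l²)/2, and every row and column sum of w(k - l) is at most the
-- full sum of w.
omit [Fintype ι] [DecidableEq ι] in
theorem sum_sum_mul_le_tsum_mul {w : (ι → ℤ) → ℝ} (hw : Summable w) (hw0 : ∀ j, 0 ≤ w j)
    (F : Finset (ι → ℤ)) (x : (ι → ℤ) → ℝ) :
    ∑ k ∈ F, ∑ l ∈ F, w (k - l) * (x k * x l) ≤ (∑' j, w j) * ∑ k ∈ F, x k ^ 2 := by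
  have h1 : ∀ k, ∑ l ∈ F, w (k - l) ≤ ∑' j, w j := fun k => by
    rw [← (Equiv.subLeft k).tsum_eq w]
    exact ((Equiv.subLeft k).summable_iff.2 hw).sum_le_tsum F fun _ _ => hw0 _
  have h2 : ∀ l, ∑ k ∈ F, w (k - l) ≤ ∑' j, w j := fun l => by
    rw [← (Equiv.subRight l).tsum_eq w]
    exact ((Equiv.subRight l).summable_iff.2 hw).sum_le_tsum F fun _ _ => hw0 _
  calc ∑ k ∈ F, ∑ l ∈ F, w (k - l) * (x k * x l)
      ≤ ∑ k ∈ F, ∑ l ∈ F, (w (k - l) * x k ^ 2 / 2 + w (k - l) * x l ^ 2 / 2) := by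
        refine Finset.sum_le_sum fun k _ => Finset.sum_le_sum fun l _ => ?_
        nlinarith [mul_nonneg (hw0 (k - l)) (sq_nonneg (x k - x l))]
    _ = ∑ k ∈ F, (∑ l ∈ F, w (k - l)) * (x k ^ 2 / 2) +
          ∑ l ∈ F, (∑ k ∈ F, w (k - l)) * (x l ^ 2 / 2) := by
        simp only [Finset.sum_add_distrib]
        rw [Finset.sum_comm (f := fun k l => w (k - l) * x l ^ 2 / 2)]
        simp only [Finset.sum_mul, mul_div_assoc]
    _ ≤ ∑ k ∈ F, (∑' j, w j) * (x k ^ 2 / 2) + ∑ l ∈ F, (∑' j, w j) * (x l ^ 2 / 2) := by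
        gcongr with k _ l _
        · exact h1 k
        · exact h2 l
    _ = (∑' j, w j) * ∑ k ∈ F, x k ^ 2 := by
        rw [← Finset.mul_sum, ← mul_add, ← Finset.sum_add_distrib]
        simp

theorem sum_box_ite {X : Type*} [AddCommMonoid X] (F : Finset (ι → ℤ)) (R : ℕ) (m : ι → ℤ)
    (G : (ι → ℤ) → X) :
    ∑ q ∈ box ι R, (if q + m ∈ F then G (q + m) else 0) =
      ∑ k ∈ F, if k - m ∈ box ι R then G k else 0 := by
  rw [← Finset.sum_filter, ← Finset.sum_filter]
  refine Finset.sum_nbij' (· + m) (· - m) ?_ ?_ ?_ ?_ ?_ <;> simp +contextual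

/-- The substitution q = k - m matches the box positions m seeing both k and l with the points
counted on the right. -/
theorem sum_boole_box (F : Finset (ι → ℤ)) (R : ℕ) {k : ι → ℤ} (hk : k ∈ F) (l : ι → ℤ) :
    ∑ m ∈ Finset.image₂ (· - ·) F (box ι R),
      (if k - m ∈ box ι R ∧ l - m ∈ box ι R then (1 : ℝ) else 0) =
      ((box ι R).filter fun q => q - (k - l) ∈ box ι R).card := by
  rw [Finset.sum_boole]
  congr 1
  refine Finset.card_nbij' (k - ·) (k - ·) ?_ ?_ ?_ ?_
  · intro m
    simp +contextual
  · intro q hq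
    simp only [Finset.coe_filter, Set.mem_ofPred_eq] at hq ⊢
    refine ⟨Finset.mem_image₂.2 ⟨k, hk, q, hq.1, rfl⟩, by simpa using hq.1, ?_⟩
    convert hq.2 using 1
    abel
  · intro m _; simp
  · intro m _; simp

variable {H : Type*} [NormedAddCommGroup H] [InnerProductSpace ℂ H]

/-- A uniform lower Riesz bound on all translates of a large box gives a global one, provided the
Gram matrix has summable off-diagonal decay. -/
theorem riesz_of_local {e : (ι → ℤ) → H} {φ : (ι → ℤ) → ℝ} (hφ : Summable φ)
    (hφ0 : ∀ j, 0 ≤ φ j) (hgram : ∀ k l, ‖inner ℂ (e k) (e l)‖ ≤ φ (k - l)) {R : ℕ} (hR : 0 < R)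
    {a : ℝ} (hloc : ∀ m (c : (ι → ℤ) → ℂ), a * ∑ q ∈ box ι R, ‖c q‖ ^ 2 ≤
      ‖∑ q ∈ box ι R, c q • e (q + m)‖ ^ 2) (F : Finset (ι → ℤ)) (c : (ι → ℤ) → ℂ) :
    (a - ∑' j, φ j * boxDefect R j) * ∑ k ∈ F, ‖c k‖ ^ 2 ≤ ‖∑ k ∈ F, c k • e k‖ ^ 2 := by
  -- All positions m at which the translated box meets F.
  set M := Finset.image₂ (· - ·) F (box ι R)
  set N : ℝ := (R : ℝ) ^ Fintype.card ι
  have hN : 0 < N := by positivity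
  set x : (ι → ℤ) → H := fun k => c k • e k
  set y : (ι → ℤ) → H := fun m => ∑ k ∈ F, if k - m ∈ box ι R then x k else 0
  set γ : (ι → ℤ) → (ι → ℤ) → ℝ := fun k l => (inner ℂ (x k) (x l) : ℂ).re
  have hnorm : ∀ z : H, ‖z‖ ^ 2 = (inner ℂ z z : ℂ).re := fun z => by
    rw [inner_self_eq_norm_sq_to_K]; norm_cast
  have hy : ∀ m, ‖y m‖ ^ 2 = ∑ k ∈ F, ∑ l ∈ F,
      (if k - m ∈ box ι R ∧ l - m ∈ box ι R then (1 : ℝ) else 0) * γ k l := fun m => by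
    rw [hnorm, sum_inner, Complex.re_sum]
    refine Finset.sum_congr rfl fun k _ => ?_
    rw [inner_sum, Complex.re_sum]
    refine Finset.sum_congr rfl fun l _ => ?_
    by_cases h1 : k - m ∈ box ι R <;> by_cases h2 : l - m ∈ box ι R <;> simp [h1, h2, γ]
  -- Summing over positions sees each pair (k, l) with weight N(1 - `boxDefect`), N being the box
  -- cardinality. What is missing from N‖∑ c_k e_k‖² is the defect term, bounded below in `hdef`.
  have hysum : ∑ m ∈ M, ‖y m‖ ^ 2 = ∑ k ∈ F, ∑ l ∈ F, (N - N * boxDefect R (k - l)) * γ k l := by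
    simp only [hy]
    rw [Finset.sum_comm]
    refine Finset.sum_congr rfl fun k hk => ?_
    rw [Finset.sum_comm]
    refine Finset.sum_congr rfl fun l _ => ?_
    rw [← Finset.sum_mul, sum_boole_box F R hk l, mul_boxDefect hR]
    ring
  have hlocy : ∀ m, a * ∑ k ∈ F, (if k - m ∈ box ι R then ‖c k‖ ^ 2 else 0) ≤ ‖y m‖ ^ 2 := fun m => by
    have h := hloc m fun q => if q + m ∈ F then c (q + m) else 0
    have h1 : ∀ q, ‖(if q + m ∈ F then c (q + m) else 0 : ℂ)‖ ^ 2 =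
        if q + m ∈ F then ‖c (q + m)‖ ^ 2 else 0 := fun q => by split_ifs <;> simp
    have h2 : ∀ q, (if q + m ∈ F then c (q + m) else 0 : ℂ) • e (q + m) =
        if q + m ∈ F then x (q + m) else 0 := fun q => by split_ifs <;> simp [x]
    simp only [h1, h2] at h
    rw [sum_box_ite F R m fun k => ‖c k‖ ^ 2, sum_box_ite F R m x] at h
    exact h
  have hcount : ∑ m ∈ M, ∑ k ∈ F, (if k - m ∈ box ι R then ‖c k‖ ^ 2 else 0) =
      N * ∑ k ∈ F, ‖c k‖ ^ 2 := by
    rw [Finset.sum_comm, Finset.mul_sum]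
    refine Finset.sum_congr rfl fun k hk => ?_
    have h := sum_boole_box F R hk k
    simp only [and_self, sub_self, sub_zero, Finset.filter_mem_eq_inter, Finset.inter_self,
      card_box, Nat.cast_pow] at h
    change ∑ m ∈ M, _ = N at h
    rw [← h, Finset.sum_mul]
    simp only [ite_mul, one_mul, zero_mul]
  have hγ : ∀ k l, -(φ (k - l) * (‖c k‖ * ‖c l‖)) ≤ γ k l := fun k l => by
    refine neg_le_of_abs_le ((Complex.abs_re_le_norm _).trans ?_)
    simp only [x]
    rw [inner_smul_left, inner_smul_right, norm_mul, norm_mul, RCLike.norm_conj]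
    nlinarith [mul_le_mul_of_nonneg_left (hgram k l) (by positivity : 0 ≤ ‖c k‖ * ‖c l‖)]
  have hdef : N * -((∑' j, φ j * boxDefect R j) * ∑ k ∈ F, ‖c k‖ ^ 2) ≤
      ∑ k ∈ F, ∑ l ∈ F, N * boxDefect R (k - l) * γ k l := by
    have h := sum_sum_mul_le_tsum_mul (w := fun j => φ j * boxDefect R j)
      (Summable.of_nonneg_of_le (fun j => mul_nonneg (hφ0 j) (boxDefect_nonneg j))
        (fun j => mul_le_of_le_one_right (hφ0 j) (boxDefect_le_one R j)) hφ)
      (fun j => mul_nonneg (hφ0 j) (boxDefect_nonneg j)) F fun k => ‖c k‖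
    refine (mul_le_mul_of_nonneg_left (neg_le_neg h) hN.le).trans ?_
    rw [← Finset.sum_neg_distrib, Finset.mul_sum]
    refine Finset.sum_le_sum fun k _ => ?_
    rw [← Finset.sum_neg_distrib, Finset.mul_sum]
    refine Finset.sum_le_sum fun l _ => ?_
    have := mul_le_mul_of_nonneg_left (hγ k l)
      (mul_nonneg hN.le (boxDefect_nonneg (R := R) (k - l)))
    linarith
  have hf : ‖∑ k ∈ F, x k‖ ^ 2 = ∑ k ∈ F, ∑ l ∈ F, γ k l := by
    rw [hnorm, sum_inner, Complex.re_sum]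
    refine Finset.sum_congr rfl fun k _ => ?_
    rw [inner_sum, Complex.re_sum]
  have htotal : N * ‖∑ k ∈ F, x k‖ ^ 2 = ∑ m ∈ M, ‖y m‖ ^ 2 +
      ∑ k ∈ F, ∑ l ∈ F, N * boxDefect R (k - l) * γ k l := by
    rw [hf, hysum, Finset.mul_sum, ← Finset.sum_add_distrib]
    refine Finset.sum_congr rfl fun k _ => ?_
    rw [Finset.mul_sum, ← Finset.sum_add_distrib]
    exact Finset.sum_congr rfl fun l _ => by ring
  have hlow : N * (a * ∑ k ∈ F, ‖c k‖ ^ 2) ≤ ∑ m ∈ M, ‖y m‖ ^ 2 := by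
    calc N * (a * ∑ k ∈ F, ‖c k‖ ^ 2)
        = ∑ m ∈ M, a * ∑ k ∈ F, (if k - m ∈ box ι R then ‖c k‖ ^ 2 else 0) := by
          rw [← Finset.mul_sum, hcount]; ring
      _ ≤ _ := Finset.sum_le_sum fun m _ => hlocy m
  refine le_of_mul_le_mul_left ?_ hN
  rw [htotal]
  linarith

/-- By Cauchy–Schwarz the perturbation moves the combination by at most a quarter of its norm, and
(3/4)² ≥ 1/2. -/
theorem half_mul_sum_sq_le_of_close {K : Type*} {Q : Finset K} {e e' : K → H} {c : K → ℂ} {a : ℝ}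
    (ha : 0 < a) (he : a * ∑ q ∈ Q, ‖c q‖ ^ 2 ≤ ‖∑ q ∈ Q, c q • e q‖ ^ 2)
    (hclose : ∑ q ∈ Q, ‖e' q - e q‖ ^ 2 ≤ a / 16) :
    a / 2 * ∑ q ∈ Q, ‖c q‖ ^ 2 ≤ ‖∑ q ∈ Q, c q • e' q‖ ^ 2 := by
  set s := ∑ q ∈ Q, ‖c q‖ ^ 2
  set v := ∑ q ∈ Q, c q • e q
  set v' := ∑ q ∈ Q, c q • e' q
  have hs : 0 ≤ s := by positivity
  have hd : ‖v' - v‖ ^ 2 ≤ a / 16 * s := by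
    have : ‖v' - v‖ ≤ ∑ q ∈ Q, ‖c q‖ * ‖e' q - e q‖ := by
      simp only [v, v', ← Finset.sum_sub_distrib, ← smul_sub]
      exact (norm_sum_le _ _).trans_eq (Finset.sum_congr rfl fun q _ => norm_smul _ _)
    calc ‖v' - v‖ ^ 2 ≤ _ := pow_le_pow_left₀ (norm_nonneg _) this 2
      _ ≤ s * _ := Finset.sum_mul_sq_le_sq_mul_sq _ _ _
      _ ≤ s * (a / 16) := by gcongr
      _ = _ := mul_comm _ _
  have hd' : ‖v' - v‖ ≤ ‖v‖ / 4 := by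
    refine abs_le_of_sq_le_sq' ?_ (by positivity) |>.2
    linarith
  have h3 : 3 / 4 * ‖v‖ ≤ ‖v'‖ := by
    have := norm_sub_norm_le v v'
    rw [norm_sub_rev] at this
    linarith
  have h4 : (3 / 4 * ‖v‖) ^ 2 ≤ ‖v'‖ ^ 2 := pow_le_pow_left₀ (by positivity) h3 2
  have h5 : 0 ≤ a * s := by positivity
  linarith

end Localization

/-! ### Stability under dilation. -/

section Dilation

variable {ι : Type*} [Fintype ι] [DecidableEq ι]
variable {H : Type*} [NormedAddCommGroup H] [InnerProductSpace ℂ H]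

/-- Stability of the lower Riesz bound under small dilations of the lattice. -/
theorem IsMoyalSystem.eventually_riesz_dilate {U : (ι → ℝ) → H →ₗᵢ[ℂ] H} {κ : ℝ} {f₀ : H}
    (hU : IsMoyalSystem U κ f₀) (g : H) {a : ℝ} (ha : 0 < a)
    (hg : ∀ (F : Finset (ι → ℤ)) (c : (ι → ℤ) → ℂ),
      a * ∑ k ∈ F, ‖c k‖ ^ 2 ≤ ‖∑ k ∈ F, c k • U (intVec k) g‖ ^ 2)
    {φ : (ι → ℤ) → ℝ} (hφ : Summable φ)
    (hφg : ∀ α ∈ Set.Icc (1 / 2 : ℝ) 1, ∀ k, ‖inner ℂ (U (α • intVec k) g) g‖ ≤ φ k) :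
    ∀ᶠ α in 𝓝[<] (1 : ℝ), ∀ (F : Finset (ι → ℤ)) (c : (ι → ℤ) → ℂ),
      a / 4 * ∑ k ∈ F, ‖c k‖ ^ 2 ≤ ‖∑ k ∈ F, c k • U (α • intVec k) g‖ ^ 2 := by
  have hφ0 : ∀ j, 0 ≤ φ j := fun j =>
    (norm_nonneg _).trans (hφg 1 ⟨by norm_num, le_rfl⟩ j)
  -- The box size is fixed before α: φ dominates the Gram matrices of all dilations in [1/2, 1] at
  -- once.
  obtain ⟨R, hRlt, hR⟩ := (((tendsto_tsum_mul_boxDefect hφ hφ0).eventually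
    (gt_mem_nhds (by positivity : 0 < a / 4))).and (eventually_gt_atTop 0)).exists
  have hcont : Tendsto (fun α : ℝ => ∑ q ∈ box ι R, ‖U (α • intVec q) g - U (intVec q) g‖ ^ 2)
      (𝓝[<] 1) (𝓝 0) := by
    have : Continuous fun α : ℝ => ∑ q ∈ box ι R, ‖U (α • intVec q) g - U (intVec q) g‖ ^ 2 := by
      refine continuous_finsetSum _ fun q _ => Continuous.pow (Continuous.norm ?_) 2
      exact ((hU.continuous g).comp (continuous_id.smul continuous_const)).sub continuous_const
    have h := this.tendsto 1
    simp only [one_smul, sub_self, norm_zero] at h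
    simpa using h.mono_left nhdsWithin_le_nhds
  have h1 : ∀ᶠ α : ℝ in 𝓝[<] 1, α ∈ Set.Icc (1 / 2 : ℝ) 1 :=
    mem_of_superset (Ioo_mem_nhdsLT (by norm_num : (1 / 2 : ℝ) < 1)) Set.Ioo_subset_Icc_self
  filter_upwards [h1, hcont.eventually (gt_mem_nhds (by positivity : 0 < a / 16))] with α hα hclose F c
  have hbase : ∀ c : (ι → ℤ) → ℂ, a / 2 * ∑ q ∈ box ι R, ‖c q‖ ^ 2 ≤
      ‖∑ q ∈ box ι R, c q • U (α • intVec q) g‖ ^ 2 := fun c =>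
    half_mul_sum_sq_le_of_close ha (hg _ c) hclose.le
  -- Translating the box by m applies an isometry and multiplies the coefficients by unimodular
  -- phases, so the bound for one box serves all.
  have hloc : ∀ m (c : (ι → ℤ) → ℂ), a / 2 * ∑ q ∈ box ι R, ‖c q‖ ^ 2 ≤
      ‖∑ q ∈ box ι R, c q • U (α • intVec (q + m)) g‖ ^ 2 := fun m c => by
    have h2 : ∀ q : ι → ℤ, ∃ τ : ℂ, ‖τ‖ = 1 ∧
        U (α • intVec (q + m)) g = τ • U (α • intVec m) (U (α • intVec q) g) := fun q => by
      obtain ⟨τ, hτ, h⟩ := hU.apply_eq_smul (α • intVec m) (α • intVec (q + m))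
      refine ⟨τ, hτ, ?_⟩
      rw [h, ← smul_sub, ← intVec_sub, add_sub_cancel_right]
    choose τ hτ hτ' using h2
    have h3 := hbase fun q => c q * τ q
    simp only [norm_mul, hτ, mul_one] at h3
    have h4 : ∑ q ∈ box ι R, c q • U (α • intVec (q + m)) g =
        U (α • intVec m) (∑ q ∈ box ι R, (c q * τ q) • U (α • intVec q) g) := by
      simp only [hτ', smul_smul, map_sum, map_smul]
    rw [h4, LinearIsometry.norm_map]
    exact h3
  have hgram : ∀ k l : ι → ℤ, ‖inner ℂ (U (α • intVec k) g) (U (α • intVec l) g)‖ ≤ φ (k - l) :=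
    fun k l => by
      rw [hU.norm_inner_apply, ← smul_sub, ← intVec_sub]
      exact hφg α hα _
  have h := riesz_of_local (e := fun k => U (α • intVec k) g) hφ hφ0 hgram hR hloc F c
  refine le_trans ?_ h
  gcongr
  linarith

end Dilation

/-! ### The density bound for Riesz sequences. -/

section Density

variable {H : Type*} [NormedAddCommGroup H] [InnerProductSpace ℂ H]

/-- The span of a finite Riesz sequence has an orthonormal basis of the same cardinality, and the
projection onto it is controlled by the Riesz sequence. -/
theorem exists_orthonormal_of_riesz {K : Type*} (e : K → H) (F : Finset K) {a : ℝ} (ha : 0 < a)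
    (he : ∀ c : K → ℂ, a * ∑ k ∈ F, ‖c k‖ ^ 2 ≤ ‖∑ k ∈ F, c k • e k‖ ^ 2) :
    ∃ w : Fin F.card → H, Orthonormal ℂ w ∧
      ∀ f, a * ∑ i, ‖inner ℂ (w i) f‖ ^ 2 ≤ ∑ k ∈ F, ‖inner ℂ (e k) f‖ ^ 2 := by
  classical
  have hext : ∀ c : F → ℂ, ∃ c' : K → ℂ, ∀ k : F, c' k = c k := fun c =>
    ⟨fun k => if h : k ∈ F then c ⟨k, h⟩ else 0, fun k => by simp⟩
  have hli : LinearIndependent ℂ fun k : F => e k := by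
    rw [Fintype.linearIndependent_iff]
    intro c hc k
    obtain ⟨c', hc'⟩ := hext c
    have h := he c'
    rw [← Finset.sum_coe_sort F fun k => c' k • e k] at h
    simp only [hc', hc, norm_zero] at h
    have h1 : ‖c' k‖ ^ 2 ≤ ∑ k ∈ F, ‖c' k‖ ^ 2 :=
      Finset.single_le_sum (f := fun k => ‖c' k‖ ^ 2) (fun _ _ => by positivity) k.2
    have h2 : ‖c' k‖ ^ 2 ≤ 0 := h1.trans (by nlinarith)
    rw [← hc']
    simpa using h2
  set W := Submodule.span ℂ (Set.range fun k : F => e k)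
  have hfin : FiniteDimensional ℂ W := FiniteDimensional.span_of_finite ℂ (Set.finite_range _)
  have hrank : Module.finrank ℂ W = F.card := by
    rw [finrank_span_eq_card hli, Fintype.card_coe]
  set w := (stdOrthonormalBasis ℂ W).reindex (finCongr hrank)
  have hw : Orthonormal ℂ fun i => (w i : H) := w.orthonormal.comp_linearIsometry W.subtypeₗᵢ
  refine ⟨fun i => w i, hw, fun f => ?_⟩
  -- The orthogonal projection of f onto W. Expanding s = ‖y‖² = ⟨y, f⟩ in the e_k, Cauchy–Schwarz
  -- and the Riesz bound give a s² ≤ s B.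
  set y : W := ∑ i, inner ℂ (w i : H) f • w i
  set s := ∑ i, ‖inner ℂ (w i : H) f‖ ^ 2
  set B := ∑ k ∈ F, ‖inner ℂ (e k) f‖ ^ 2
  have hycoe : (y : H) = ∑ i, inner ℂ (w i : H) f • (w i : H) := by simp [y]
  have hy1 : ‖(y : H)‖ ^ 2 = s := by
    have h := @inner_self_eq_norm_sq_to_K ℂ H _ _ _ (y : H)
    rw [hycoe, hw.inner_sum] at h
    simp only [Complex.conj_mul'] at h
    rw [hycoe]
    refine Complex.ofReal_injective (Eq.trans ?_ (h.symm.trans ?_))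
    · push_cast; rfl
    · push_cast [s]; rfl
  have hy2 : (inner ℂ (y : H) f : ℂ) = s := by
    rw [hycoe, sum_inner]
    simp only [inner_smul_left, Complex.conj_mul', s]
    push_cast
    rfl
  obtain ⟨c, hc⟩ := (Submodule.mem_span_range_iff_exists_fun ℂ).1 y.2
  obtain ⟨c', hc'⟩ := hext c
  have hyc : (y : H) = ∑ k ∈ F, c' k • e k := by
    rw [← hc, ← Finset.sum_coe_sort F fun k => c' k • e k]
    simp only [hc']
  have h1 : a * ∑ k ∈ F, ‖c' k‖ ^ 2 ≤ s := by rw [← hy1, hyc]; exact he c'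
  have hs : 0 ≤ s := by positivity
  have hB : 0 ≤ B := by positivity
  have h2 : s ≤ ∑ k ∈ F, ‖c' k‖ * ‖inner ℂ (e k) f‖ := by
    calc s = ‖(inner ℂ (y : H) f : ℂ)‖ := by rw [hy2, Complex.norm_real, Real.norm_of_nonneg hs]
      _ ≤ _ := by
        rw [hyc, sum_inner]
        refine (norm_sum_le _ _).trans_eq (Finset.sum_congr rfl fun k _ => ?_)
        rw [inner_smul_left, norm_mul, RCLike.norm_conj]
  have h3 : s ^ 2 ≤ (∑ k ∈ F, ‖c' k‖ ^ 2) * B :=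
    (pow_le_pow_left₀ hs h2 2).trans (Finset.sum_mul_sq_le_sq_mul_sq _ _ _)
  rcases hs.eq_or_lt with h0 | h0
  · rw [← h0, mul_zero]; exact hB
  · refine le_of_mul_le_mul_right ?_ h0
    calc a * s * s = a * s ^ 2 := by ring
      _ ≤ a * ((∑ k ∈ F, ‖c' k‖ ^ 2) * B) := by gcongr
      _ = (a * ∑ k ∈ F, ‖c' k‖ ^ 2) * B := by ring
      _ ≤ s * B := by gcongr
      _ = B * s := mul_comm _ _

variable {ι : Type*} [Fintype ι]

theorem tendsto_setLIntegral_norm_gt {Φ : (ι → ℝ) → ℝ≥0∞} (hΦ : Measurable Φ)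
    (hfin : ∫⁻ u, Φ u ≠ ∞) :
    Tendsto (fun n : ℕ => ∫⁻ u in {u : ι → ℝ | (n : ℝ) < ‖u‖}, Φ u) atTop (𝓝 0) := by
  have hm : ∀ n : ℕ, MeasurableSet {u : ι → ℝ | (n : ℝ) < ‖u‖} := fun n =>
    measurableSet_lt measurable_const measurable_norm
  simp only [← lintegral_indicator (hm _)]
  have h := tendsto_lintegral_of_dominated_convergence (μ := (volume : Measure (ι → ℝ)))
    (F := fun n : ℕ => Set.indicator {u : ι → ℝ | (n : ℝ) < ‖u‖} Φ) (f := fun _ => 0) Φ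
    (fun n => hΦ.indicator (hm n))
    (fun n => Eventually.of_forall fun u => Set.indicator_le_self _ _ _) hfin
    (Eventually.of_forall fun u => ?_)
  · simpa using h
  · refine tendsto_const_nhds.congr' ?_
    filter_upwards [eventually_ge_atTop ⌈‖u‖⌉₊] with n hn
    rw [Set.indicator_of_notMem]
    exact not_lt.2 (Nat.ceil_le.1 hn)

variable [DecidableEq ι]

/-- For k in the box, ‖u + k‖ ≤ ρ forces u into the negative box enlarged by ρ on each side; the
complement therefore only sees the tail of Φ. -/
theorem setLIntegral_box_translate_le {Φ : (ι → ℝ) → ℝ≥0∞} (hΦ : Measurable Φ) {R ρ : ℕ}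
    {k : ι → ℤ} (hk : k ∈ box ι R) :
    ∫⁻ u in (Set.Icc (fun _ => -((R : ℝ) + ρ)) fun _ => (ρ : ℝ))ᶜ, Φ (u + intVec k) ≤
      ∫⁻ u in {u : ι → ℝ | (ρ : ℝ) < ‖u‖}, Φ u := by
  have hm : MeasurableSet {u : ι → ℝ | (ρ : ℝ) < ‖u‖} :=
    measurableSet_lt measurable_const measurable_norm
  rw [← (measurePreserving_add_right (volume : Measure (ι → ℝ)) (intVec k)
    ).setLIntegral_comp_preimage hm hΦ]
  refine lintegral_mono_set fun u hu => ?_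
  by_contra hnot
  simp only [Set.mem_preimage, Set.mem_ofPred_eq, not_lt] at hnot
  rw [pi_norm_le_iff_of_nonneg (by positivity)] at hnot
  refine hu ⟨fun i => ?_, fun i => ?_⟩
  all_goals
    have h1 := abs_le.1 (hnot i)
    have h2 := mem_box.1 hk i
    have h3 : (0 : ℝ) ≤ k i := by exact_mod_cast h2.1
    have h4 : (k i : ℝ) ≤ R := by exact_mod_cast h2.2.le
    simp only [Pi.add_apply, intVec_apply] at h1
    linarith

/-- A Riesz sequence along `ℤ^ι` has at most critical density. -/
theorem IsMoyalSystem.one_le_of_riesz {U : (ι → ℝ) → H →ₗᵢ[ℂ] H} {κ : ℝ} {f₀ : H}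
    (hU : IsMoyalSystem U κ f₀) (hκ : 0 < κ) (g : H) {a : ℝ} (ha : 0 < a)
    (hg : ∀ (F : Finset (ι → ℤ)) (c : (ι → ℤ) → ℂ),
      a * ∑ k ∈ F, ‖c k‖ ^ 2 ≤ ‖∑ k ∈ F, c k • U (intVec k) g‖ ^ 2) : 1 ≤ κ := by
  set Φ : (ι → ℝ) → ℝ≥0∞ := fun u => ‖inner ℂ (U u g) f₀‖ₑ ^ 2
  set N := Fintype.card ι
  have hΦ : Measurable Φ := hU.measurable_enorm_inner g
  have hΦfin : ∫⁻ u, Φ u ≠ ∞ := fun h => by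
    have := hU.lintegral_eq g
    rw [h, ENNReal.mul_top (by simpa using hκ)] at this
    exact (by finiteness : ‖g‖ₑ ^ 2 ≠ ∞) this.symm
  set t : ℕ → ℝ≥0∞ := fun ρ => ∫⁻ u in {u : ι → ℝ | (ρ : ℝ) < ‖u‖}, Φ u
  have ht : ∀ ρ, t ρ ≠ ∞ := fun ρ =>
    ((setLIntegral_le_lintegral _ _).trans_lt hΦfin.lt_top).ne
  have toE : ∀ (x : ℂ), ‖x‖ₑ ^ 2 = ENNReal.ofReal (‖x‖ ^ 2) := fun x => by
    rw [← ofReal_norm, ENNReal.ofReal_pow (norm_nonneg _)]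
  have hmain : ∀ R ρ : ℕ, (R : ℝ) ^ N ≤
      κ * (((R : ℝ) + 2 * ρ) ^ N + (R : ℝ) ^ N * ((t ρ).toReal / a)) := by
    intro R ρ
    obtain ⟨w, hw, hwe⟩ := exists_orthonormal_of_riesz (fun k : ι → ℤ => U (intVec k) g)
      (box ι R) ha (hg _)
    -- p(u) is the squared norm of the projection of U(-u) f₀ onto the span of the box. Its integral
    -- is dimension/κ = R^N/κ; it is at most 1 by Bessel, and small far from the box by the Riesz
    -- bound.
    set p : (ι → ℝ) → ℝ≥0∞ := fun u => ∑ i, ‖inner ℂ (U u (w i)) f₀‖ₑ ^ 2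
    have hp : ∀ u, p u = ENNReal.ofReal (∑ i, ‖inner ℂ (w i) (U (-u) f₀)‖ ^ 2) := fun u => by
      rw [ENNReal.ofReal_sum_of_nonneg fun i _ => by positivity]
      refine Finset.sum_congr rfl fun i _ => ?_
      rw [toE, ← hU.norm_inner_apply_zero (w i), hU.norm_inner_apply, zero_sub, neg_neg]
    have hp1 : ∀ u, p u ≤ 1 := fun u => by
      rw [hp, ← ENNReal.ofReal_one]
      refine ENNReal.ofReal_le_ofReal ((hw.sum_inner_products_le _).trans_eq ?_)
      rw [LinearIsometry.norm_map, hU.norm_window, one_pow]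
    have hp2 : ∀ u, p u ≤ ENNReal.ofReal a⁻¹ * ∑ k ∈ box ι R, Φ (u + intVec k) := fun u => by
      have h1 : ∀ k, Φ (u + intVec k) =
          ENNReal.ofReal (‖inner ℂ (U (intVec k) g) (U (-u) f₀)‖ ^ 2) := fun k => by
        rw [hU.norm_inner_apply, sub_neg_eq_add, add_comm, ← toE]
      simp only [h1]
      rw [hp, ← ENNReal.ofReal_sum_of_nonneg fun i _ => by positivity,
        ← ENNReal.ofReal_mul (by positivity)]
      refine ENNReal.ofReal_le_ofReal ?_
      rw [inv_mul_eq_div, le_div_iff₀ ha, mul_comm]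
      exact hwe _
    have hpint : ENNReal.ofReal κ * ∫⁻ u, p u = ENNReal.ofReal ((R : ℝ) ^ N) := by
      rw [lintegral_finsetSum _ fun i _ => hU.measurable_enorm_inner (w i), Finset.mul_sum]
      simp only [hU.lintegral_eq]
      have : ∀ i, ‖w i‖ₑ ^ 2 = 1 := fun i => by rw [← ofReal_norm, hw.1 i]; simp
      simp only [this, Finset.sum_const, Finset.card_univ, Fintype.card_fin, card_box]
      simp [N]
    set E : Set (ι → ℝ) := Set.Icc (fun _ => -((R : ℝ) + ρ)) fun _ => (ρ : ℝ)
    have hE : MeasurableSet E := measurableSet_Icc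
    have hEvol : volume E = ENNReal.ofReal (((R : ℝ) + 2 * ρ) ^ N) := by
      simp only [E, Real.volume_Icc_pi, Finset.prod_const, Finset.card_univ, N]
      rw [← ENNReal.ofReal_pow (by linarith [R.cast_nonneg (α := ℝ), ρ.cast_nonneg (α := ℝ)])]
      congr 2
      ring
    have hin : ∫⁻ u in E, p u ≤ ENNReal.ofReal (((R : ℝ) + 2 * ρ) ^ N) := by
      rw [← hEvol, ← setLIntegral_one]
      exact lintegral_mono hp1
    have hout : ∫⁻ u in Eᶜ, p u ≤ ENNReal.ofReal ((R : ℝ) ^ N * ((t ρ).toReal / a)) := by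
      calc ∫⁻ u in Eᶜ, p u
          ≤ ∫⁻ u in Eᶜ, ENNReal.ofReal a⁻¹ * ∑ k ∈ box ι R, Φ (u + intVec k) :=
            lintegral_mono hp2
        _ = ENNReal.ofReal a⁻¹ * ∑ k ∈ box ι R, ∫⁻ u in Eᶜ, Φ (u + intVec k) := by
            have hm : ∀ k, Measurable fun u => Φ (u + intVec k) := fun k =>
              hΦ.comp (measurable_id.add_const _)
            rw [lintegral_const_mul _ (Finset.measurable_fun_sum _ fun k _ => hm k),
              lintegral_finsetSum _ fun k _ => hm k]
        _ ≤ ENNReal.ofReal a⁻¹ * ∑ k ∈ box ι R, t ρ := by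
            gcongr with k hk
            exact setLIntegral_box_translate_le hΦ hk
        _ = _ := by
            rw [Finset.sum_const, card_box, nsmul_eq_mul, ← ENNReal.ofReal_toReal (ht ρ),
              ENNReal.toReal_ofReal ENNReal.toReal_nonneg,
              ← ENNReal.ofReal_natCast, ← ENNReal.ofReal_mul (by positivity),
              ← ENNReal.ofReal_mul (by positivity)]
            congr 1
            push_cast
            ring
    have h := hpint.symm.le
    rw [← lintegral_add_compl _ hE] at h
    replace h := h.trans (mul_le_mul_right (add_le_add hin hout) _)
    rwa [← ENNReal.ofReal_add (by positivity) (by positivity), ← ENNReal.ofReal_mul hκ.le,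
      ENNReal.ofReal_le_ofReal_iff (by positivity)] at h
  -- First R → ∞ with ρ fixed removes the boundary layer; then ρ → ∞ removes the tail.
  have hlim : ∀ ρ : ℕ, 1 ≤ κ * (1 + (t ρ).toReal / a) := fun ρ => by
    have h1 : Tendsto (fun R : ℕ => 1 + 2 * (ρ : ℝ) / R) atTop (𝓝 (1 + 0)) :=
      (tendsto_const_div_atTop_nhds_zero_nat (2 * (ρ : ℝ))).const_add 1
    have h2 : Tendsto (fun R : ℕ => κ * ((1 + 2 * (ρ : ℝ) / R) ^ N + (t ρ).toReal / a)) atTop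
        (𝓝 (κ * ((1 + 0) ^ N + (t ρ).toReal / a))) := ((h1.pow N).add_const _).const_mul κ
    rw [add_zero, one_pow] at h2
    refine ge_of_tendsto h2 ((eventually_gt_atTop 0).mono fun R hR => ?_)
    have hR' : (0 : ℝ) < R := by exact_mod_cast hR
    refine le_of_mul_le_mul_left ?_ (by positivity : (0 : ℝ) < (R : ℝ) ^ N)
    refine (mul_one _).trans_le ((hmain R ρ).trans_eq ?_)
    have : (R : ℝ) + 2 * ρ = R * (1 + 2 * (ρ : ℝ) / R) := by field_simp
    rw [this, mul_pow]
    ring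
  have htend : Tendsto (fun ρ => κ * (1 + (t ρ).toReal / a)) atTop (𝓝 (κ * (1 + 0 / a))) := by
    have h0 := (ENNReal.tendsto_toReal ENNReal.zero_ne_top).comp
      (tendsto_setLIntegral_norm_gt hΦ hΦfin)
    exact ((h0.div_const a).const_add 1).const_mul κ
  have := ge_of_tendsto' htend hlim
  simpa using this

end Density

/-! ### Summability of polynomial decay over lattices. -/

section Summability

variable {ι : Type*} [Fintype ι]

theorem summable_norm_intVec_rpow {r : ℝ} (hr : r < -(Fintype.card ι : ℝ)) :
    Summable fun k : ι → ℤ => ‖intVec k‖ ^ r := by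
  classical
  set b := Pi.basisFun ℝ ι
  set L := Submodule.span ℤ (Set.range b)
  set b' : Module.Basis ι ℤ L := b.restrictScalars ℤ
  have hrank : Module.finrank ℤ L = Fintype.card ι := Module.finrank_eq_card_basis b'
  have h := ZLattice.summable_norm_rpow L r (by rw [hrank]; exact hr)
  have h2 := b'.equivFun.symm.toEquiv.summable_iff.2 h
  refine h2.congr fun k => ?_
  simp only [Function.comp_apply, LinearEquiv.coe_toEquiv, Module.Basis.equivFun_symm_apply]
  congr 1
  rw [Submodule.coe_norm]
  congr 1
  ext i
  have hb' : ∀ x, (b' x : ι → ℝ) = Pi.single x 1 := fun x => by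
    rw [b.restrictScalars_apply ℤ x, Pi.basisFun_apply]
  simp [hb', Finset.sum_apply, Pi.single_apply]

/-- Polynomial decay of order exceeding the rank is summable over a lattice. -/
theorem summable_one_add_norm_rpow {E : Type*} [SeminormedAddCommGroup E] [Module ℝ E]
    (T : (ι → ℝ) →ₗ[ℝ] E) {K : ℝ} (hK : 0 < K) (hT : ∀ u, ‖u‖ ≤ K * ‖T u‖)
    {s : ℝ} (hs : (Fintype.card ι : ℝ) < s) :
    Summable fun k : ι → ℤ => (1 + ‖T (intVec k)‖) ^ (-s) := by
  have hs0 : 0 ≤ s := (Nat.cast_nonneg _).trans hs.le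
  refine Summable.of_norm_bounded_eventually
    ((summable_norm_intVec_rpow (ι := ι) (neg_lt_neg hs)).mul_left (K ^ s)) ?_
  -- The comparison fails at k = 0, where 0 ^ (-s) takes the value 0.
  refine (Set.finite_singleton (0 : ι → ℤ)).subset fun k hk => ?_
  by_contra h0
  refine hk ?_
  have hpos : 0 < ‖intVec k‖ := norm_pos_iff.2 fun h => h0 <| funext fun i => by
    have := congrFun h i
    simpa using this
  change ‖(1 + ‖T (intVec k)‖) ^ (-s)‖ ≤ K ^ s * ‖intVec k‖ ^ (-s)
  rw [Real.norm_of_nonneg (by positivity), Real.rpow_neg (by positivity),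
    Real.rpow_neg (by positivity), ← div_eq_mul_inv, ← Real.inv_rpow (by positivity),
    ← Real.div_rpow hK.le hpos.le]
  refine Real.rpow_le_rpow (by positivity) ?_ hs0
  rw [inv_le_comm₀ (by positivity) (by positivity), inv_div, div_le_iff₀ hK]
  nlinarith [hT (intVec k)]

end Summability

/-! ### Lattice coordinates on phase space. -/

section Lattice

variable {d : ℕ}

/-- The linear map `u ↦ A u` with values in phase space. -/
noncomputable def phaseMap (A : Matrix (Fin d ⊕ Fin d) (Fin d ⊕ Fin d) ℝ) :
    (Fin d ⊕ Fin d → ℝ) →ₗ[ℝ] PhaseSpace d :=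
  (WithLp.linearEquiv 2 ℝ (Fin d ⊕ Fin d → ℝ)).symm.toLinearMap ∘ₗ A.mulVecLin

theorem phaseMap_apply (A : Matrix (Fin d ⊕ Fin d) (Fin d ⊕ Fin d) ℝ) (u : Fin d ⊕ Fin d → ℝ) :
    phaseMap A u = WithLp.toLp 2 (A.mulVec u) := rfl

theorem phaseMap_smul (α : ℝ) (A : Matrix (Fin d ⊕ Fin d) (Fin d ⊕ Fin d) ℝ)
    (u : Fin d ⊕ Fin d → ℝ) : phaseMap (α • A) u = phaseMap A (α • u) := by
  rw [phaseMap_apply, phaseMap_apply, Matrix.smul_mulVec, Matrix.mulVec_smul]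

theorem phaseMap_injective {A : Matrix (Fin d ⊕ Fin d) (Fin d ⊕ Fin d) ℝ} (hA : IsUnit A) :
    Function.Injective (phaseMap A) :=
  (WithLp.toLp_injective 2).comp (Matrix.mulVec_injective_iff_isUnit.2 hA)

theorem exists_norm_le_mul_norm_phaseMap {A : Matrix (Fin d ⊕ Fin d) (Fin d ⊕ Fin d) ℝ}
    (hA : IsUnit A) : ∃ K : ℝ, 0 < K ∧ ∀ u, ‖u‖ ≤ K * ‖phaseMap A u‖ := by
  obtain ⟨K, hK, h⟩ := (phaseMap A).exists_antilipschitzWith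
    (LinearMap.ker_eq_bot.2 (phaseMap_injective hA))
  exact ⟨K, hK, fun u => ZeroHomClass.bound_of_antilipschitz _ h u⟩

/-- Time-frequency shifts along the coordinates of a lattice. -/
theorem isMoyalSystem_tfShift {A : Matrix (Fin d ⊕ Fin d) (Fin d ⊕ Fin d) ℝ} (hA : A.det ≠ 0)
    {f : L2 d} (hf : MemLp f ∞) (hf1 : ‖f‖ = 1) :
    IsMoyalSystem (fun u => tfShiftₗᵢ (phaseMap A u)) |A.det| f where
  comp u v := ⟨_, norm_character _ _, fun x => by
    simp only [tfShiftₗᵢ_apply, map_add]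
    exact tfShift_tfShift _ _ _⟩
  continuous x := (continuous_tfShift x).comp (phaseMap A).continuous_of_finiteDimensional
  norm_window := hf1
  lintegral_eq g := by
    simp only [tfShiftₗᵢ_apply]
    set Φ : PhaseSpace d → ℝ≥0∞ := fun z => ‖inner ℂ (tfShift z g) f‖ₑ ^ 2
    have hΦ : Measurable Φ := ((ENNReal.continuous_pow 2).comp
      ((continuous_tfShift g).inner continuous_const).enorm).measurable
    have hΦ' : Measurable fun v : Fin d ⊕ Fin d → ℝ => Φ (WithLp.toLp 2 v) :=
      hΦ.comp (WithLp.measurable_toLp 2 _)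
    have h1 : ∫⁻ v : Fin d ⊕ Fin d → ℝ, Φ (WithLp.toLp 2 v) = ‖g‖ₑ ^ 2 := by
      rw [(PiLp.volume_preserving_toLp (Fin d ⊕ Fin d)).lintegral_comp hΦ,
        lintegral_enorm_inner_tfShift_sq g f hf, ← ofReal_norm f, hf1]
      simp
    have h2 := Real.map_matrix_volume_pi_eq_smul_volume_pi hA
    -- The change of variables produces |det A|⁻¹, which κ = |det A| cancels.
    have h3 : ∫⁻ u, Φ (phaseMap A u) = ENNReal.ofReal |A.det⁻¹| * ‖g‖ₑ ^ 2 := by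
      rw [← h1, ← smul_eq_mul, ← lintegral_smul_measure, ← h2, lintegral_map hΦ']
      · rfl
      · exact (Matrix.toLin' A).continuous_of_finiteDimensional.measurable
    rw [h3, ← mul_assoc, ← ENNReal.ofReal_mul (abs_nonneg _), ← abs_mul, mul_inv_cancel₀ hA]
    simp

end Lattice

end Gabor

/-! ### The Balian–Low type theorem. -/

theorem mainTheorem7 {d : ℕ} (hd : 1 ≤ d) (g : Gabor.L2 d)
    (A : Matrix (Fin d ⊕ Fin d) (Fin d ⊕ Fin d) ℝ) (hA : IsUnit A)
    (hvol : Gabor.latticeVolume A = 1)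
    (hframe : Gabor.IsGaborFrame g (Gabor.lattice A)) :
    ∀ s : ℝ, 2 * (d : ℝ) < s → ¬ Gabor.MemModulationInfty s g := by
  open Gabor in
  rintro s hs ⟨C, hC⟩
  obtain ⟨f, hf, hf1⟩ := exists_bounded_norm_eq_one d
  have hdet : A.det ≠ 0 := ((Matrix.isUnit_iff_isUnit_det A).1 hA).ne_zero
  have hU := isMoyalSystem_tfShift hdet hf hf1
  have hdet1 : |A.det| = 1 := hvol
  rw [hdet1] at hU
  obtain ⟨a, b, ha, hb, hab⟩ := hframe
  have hinj : Function.Injective fun k : Fin d ⊕ Fin d → ℤ => phaseMap A (intVec k) :=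
    (phaseMap_injective hA).comp fun k l h => funext fun i => by
      have := congrFun h i
      simpa using this
  have hsum : ∀ h : L2 d, ∑' l : lattice A,
      ENNReal.ofReal (‖inner ℂ (tfShift (l : PhaseSpace d) g) h‖ ^ 2) =
      ∑' k : Fin d ⊕ Fin d → ℤ,
        ENNReal.ofReal (‖inner ℂ (tfShiftₗᵢ (phaseMap A (intVec k)) g) h‖ ^ 2) := fun h =>
    tsum_range (fun z => ENNReal.ofReal (‖inner ℂ (tfShift z g) h‖ ^ 2)) hinj
  simp only [hsum] at hab
  have hriesz := hU.riesz_of_frame g ha hb hab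
  obtain ⟨K, hK, hKA⟩ := exists_norm_le_mul_norm_phaseMap hA
  have hcard : (Fintype.card (Fin d ⊕ Fin d) : ℝ) < s := by
    simp only [Fintype.card_sum, Fintype.card_fin, Nat.cast_add]
    linarith
  have hs0 : 0 ≤ s := (Nat.cast_nonneg _).trans hcard.le
  have hφ : Summable fun k : Fin d ⊕ Fin d → ℤ =>
      (|C| * 2 ^ s) * (1 + ‖phaseMap A (intVec k)‖) ^ (-s) :=
    (summable_one_add_norm_rpow (phaseMap A) hK hKA hcard).mul_left _
  -- For α ≥ 1/2 one has 1 + α|z| ≥ (1 + |z|)/2; hence the factor 2^s, uniform in α.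
  have hφg : ∀ α ∈ Set.Icc (1 / 2 : ℝ) 1, ∀ k : Fin d ⊕ Fin d → ℤ,
      ‖inner ℂ (tfShiftₗᵢ (phaseMap A (α • intVec k)) g) g‖ ≤
        (|C| * 2 ^ s) * (1 + ‖phaseMap A (intVec k)‖) ^ (-s) := by
    intro α hα k
    rw [tfShiftₗᵢ_apply, inner_tfShift_eq_stft, map_smul]
    refine (hC _).trans ?_
    rw [mul_assoc]
    refine mul_le_mul (le_abs_self C) ?_ (by positivity) (abs_nonneg C)
    rw [norm_smul, Real.norm_of_nonneg (by linarith [hα.1]),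
      Real.rpow_neg (by have := hα.1; positivity), Real.rpow_neg (by positivity), ← div_eq_mul_inv,
      ← Real.div_rpow (by norm_num) (by positivity),
      ← Real.inv_rpow (by have := hα.1; positivity)]
    have hα0 : 0 < α := by linarith [hα.1]
    refine Real.rpow_le_rpow (by positivity) ?_ hs0
    rw [inv_le_comm₀ (by positivity) (by positivity), inv_div]
    nlinarith [norm_nonneg (phaseMap A (intVec k)), hα.1]
  obtain ⟨α, hα, hα01⟩ := ((hU.eventually_riesz_dilate g ha hriesz hφ hφg).and
    (Ioo_mem_nhdsLT (by norm_num : (1 / 2 : ℝ) < 1))).exists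
  have hα0 : 0 < α := by linarith [hα01.1]
  have hdetα : |(α • A).det| = α ^ (2 * d) := by
    rw [Matrix.det_smul, abs_mul, hdet1, mul_one, abs_pow, abs_of_pos hα0]
    simp [two_mul]
  have hpos : 0 < |(α • A).det| := by rw [hdetα]; positivity
  have hV := isMoyalSystem_tfShift (abs_pos.1 hpos) hf hf1
  have h1 := hV.one_le_of_riesz hpos g (by positivity : 0 < a / 4) (by simpa only [phaseMap_smul] using hα)
  rw [hdetα] at h1
  -- The assumption d ≥ 1 makes the exponent 2d nonzero.
  exact absurd h1 (not_le.2 (pow_lt_one₀ hα0.le hα01.2 (by omega)))
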